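/- All groups are finite. Let $\pi$ be a set of primes and $\pi'$ its complement in the set of all primes. For a set of primes $\rho$, a group is $\rho$-soluble if every composition factor is a $\rho$-group or a $\rho'$-group and every composition factor that is a $\rho$-group is a $p$-group for some $p\in\rho$. Let $\mathfrak N^\pi$ be the class of groups $H\times K$ with $H$ a $\pi$-group and $K$ a nilpotent $\pi'$-group, and let $G^{\mathfrak N^\pi}$ be the smallest normal subgroup of $G$ with quotient in $\mathfrak N^\pi$. Let $O^\pi(H)$ be the smallest normal subgroup of $H$ whose quotient is a $\pi$-group. A subgroup $H\le G$ is $\mathfrak N^\pi$-Dnormal in $G$ if for every prime $p$ and every Sylow $p$-subgroup $G_p$ of $G$ such that $G_p\cap H$ is a Sylow $p$-subgroup of $H$: (1) if $p\in\pi'$, then $G_p\le N_G(H)$; (2) if $p\in\pi$, then $G_p\le N_G(H)$ when $\pi=\{p\}$, and $G_p\le N_G(O^\pi(H))$ when $|\pi|\ge 2$. A subgroup $S\le G$ is $\mathfrak N^\pi$-Dsubnormal in $G$ if there is a chain $S=S_0\le S_1\le\dots\le S_k=G$ with $S_i$ $\mathfrak N^\pi$-Dnormal in $S_{i+1}$ for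 $0\le i\le k-1$. A non-empty set $\mathcal F$ of subgroups of $G$ is an $\mathfrak N^\pi$-Fitting set of $G$ if: (FS1) if $S\in\mathcal F$ and $T$ is $\mathfrak N^\pi$-Dsubnormal in $S$, then $T\in\mathcal F$; (FS2) if $S,T\in\mathcal F$ are $\mathfrak N^\pi$-Dnormal in $\langle S,T\rangle$, then $\langle S,T\rangle\in\mathcal F$; (FS3) if $S\in\mathcal F$ and $x\in G$, then $S^x=x^{-1}Sx\in\mathcal F$. An $\mathcal F$-injector of $G$ is a subgroup $V\le G$ such that, for every subnormal subgroup $K$ of $G$, $V\cap K$ is maximal among the subgroups of $K$ belonging to $\mathcal F$. For $N\le G$, an $\mathcal F$-injector of $N$ is an injector of $N$ for the set $\{S\le N\mid S\in\mathcal F\}$. **Theorem.** Let $\mathcal F$ be an $\mathfrak N^\pi$-Fitting set of a $\pi'$-soluble group $G$. Then $G$ has exactly one conjugacy class of $\mathcal F$-injectors. Moreover, if $V$ and $V^*$ are $\mathcal F$-injectors of $G$, there exists $g\in G^{\mathfrak N^\pi}$ such that $(V^*)^g=V$. Also, if $I$ is an $\mathcal F$-injector of $G$ and $N$ is an $\mathfrak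 N^\pi$-Dnormal subgroup of $G$, then $I\cap N$ is an $\mathcal F$-injector of $N$. -/

import Mathlib

open scoped Pointwise

/-- A (finite) group is a `π`-group if every prime dividing its order lies in `π`. A set of primes is
a `Set Nat.Primes`, so that `π'`, the complement of `π` in the set of all primes, is `πᶜ`. -/
def IsPiGroup (π : Set Nat.Primes) (G : Type*) [Group G] : Prop :=
  ∀ p : Nat.Primes, (p : ℕ) ∣ Nat.card G → p ∈ π

/-- The quotient `A / B` of subgroups of a finite group `G` is a composition factor of `G`: the
subgroup `A` is subnormal in `G`, `B` is normal in `A` and `A / B` is simple (these are exactly the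
pairs of consecutive terms of composition series of `G`). -/
def IsCompositionFactor {G : Type*} [Group G] (A B : Subgroup G) [(B.subgroupOf A).Normal] : Prop :=
  A.IsSubnormal ∧ B ≤ A ∧ IsSimpleGroup (A ⧸ B.subgroupOf A)

/-- `ρ`-separable: each composition factor is a `ρ`-group or a `ρ'`-group. -/
def IsPiSeparable (ρ : Set Nat.Primes) (G : Type*) [Group G] : Prop :=
  ∀ (A B : Subgroup G) [(B.subgroupOf A).Normal], IsCompositionFactor A B →
    IsPiGroup ρ (A ⧸ B.subgroupOf A) ∨ IsPiGroup ρᶜ (A ⧸ B.subgroupOf A)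

/-- `ρ`-soluble: `ρ`-separable, and each composition factor that is a `ρ`-group is a `p`-group for
some `p ∈ ρ`. -/
def IsPiSoluble (ρ : Set Nat.Primes) (G : Type*) [Group G] : Prop :=
  IsPiSeparable ρ G ∧
    ∀ (A B : Subgroup G) [(B.subgroupOf A).Normal], IsCompositionFactor A B →
      IsPiGroup ρ (A ⧸ B.subgroupOf A) → ∃ p ∈ ρ, IsPGroup (p : ℕ) (A ⧸ B.subgroupOf A)

/-- The class `𝔑^π`: groups that are the (internal) direct product of a `π`-group and a nilpotent
`π'`-group. -/
def IsNPi (π : Set Nat.Primes) (G : Type*) [Group G] : Prop :=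
  ∃ H K : Subgroup G, H.Normal ∧ K.Normal ∧ H ⊓ K = ⊥ ∧ H ⊔ K = ⊤ ∧
    IsPiGroup π H ∧ IsPiGroup πᶜ K ∧ Group.IsNilpotent K

/-- The residual `O^π(G)`: the smallest normal subgroup of `G` whose quotient is a `π`-group. -/
def piResidual (π : Set Nat.Primes) (G : Type*) [Group G] : Subgroup G :=
  sInf {N : Subgroup G | ∃ _ : N.Normal, IsPiGroup π (G ⧸ N)}

/-- The `𝔑^π`-residual of `G`: the smallest normal subgroup of `G` whose quotient is in `𝔑^π`. -/
def nPiResidual (π : Set Nat.Primes) (G : Type*) [Group G] : Subgroup G :=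
  sInf {N : Subgroup G | ∃ _ : N.Normal, IsNPi π (G ⧸ N)}

/-- The Sylow subgroup `P` of `G` reduces into `H`: `P ∩ H` is a Sylow subgroup of `H`. -/
def ReducesInto {G : Type*} [Group G] {p : ℕ} (P : Sylow p G) (H : Subgroup G) : Prop :=
  ∃ Q : Sylow p H, (Q : Subgroup H) = (P : Subgroup G).subgroupOf H

/-- `H` is `𝔑^π`-Dnormal in the whole group `G`. -/
def IsDnormal (π : Set Nat.Primes) {G : Type*} [Group G] (H : Subgroup G) : Prop :=
  (∀ p ∈ πᶜ, ∀ P : Sylow (p : ℕ) G, ReducesInto P H →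
    (P : Subgroup G) ≤ Subgroup.normalizer (H : Set G)) ∧
  (∀ p ∈ π, ∀ P : Sylow (p : ℕ) G, ReducesInto P H →
    (π = {p} → (P : Subgroup G) ≤ Subgroup.normalizer (H : Set G)) ∧
    (π.Nontrivial →
      (P : Subgroup G) ≤
        Subgroup.normalizer (((piResidual π H).map H.subtype : Subgroup G) : Set G)))

/-- `H` is an `𝔑^π`-Dnormal subgroup of the subgroup `K` of `G`. -/
def IsDnormalIn (π : Set Nat.Primes) {G : Type*} [Group G] (H K : Subgroup G) : Prop :=
  H ≤ K ∧ IsDnormal π (H.subgroupOf K)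

/-- `H` is an `𝔑^π`-Dsubnormal subgroup of the subgroup `K` of `G`: there is a finite chain
`H = S₀ ≤ S₁ ≤ ⋯ ≤ Sₖ = K` with each `Sᵢ` being `𝔑^π`-Dnormal in `Sᵢ₊₁`. -/
def IsDsubnormalIn (π : Set Nat.Primes) {G : Type*} [Group G] (H K : Subgroup G) : Prop :=
  Relation.ReflTransGen (IsDnormalIn π) H K

/-- `𝔑^π`-Fitting sets of `G`. Here `S ^ x = x⁻¹ S x` is `MulAut.conj x⁻¹ • S`. -/
structure IsNPiFittingSet (π : Set Nat.Primes) {G : Type*} [Group G]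
    (F : Set (Subgroup G)) : Prop where
  nonempty : F.Nonempty
  fs1 : ∀ S ∈ F, ∀ T : Subgroup G, IsDsubnormalIn π T S → T ∈ F
  fs2 : ∀ S ∈ F, ∀ T ∈ F, IsDnormalIn π S (S ⊔ T) → IsDnormalIn π T (S ⊔ T) → S ⊔ T ∈ F
  fs3 : ∀ S ∈ F, ∀ x : G, MulAut.conj x⁻¹ • S ∈ F

/-- `V` is an `F`-injector of `G`: for every subnormal subgroup `K` of `G`, `V ∩ K` is maximal among
the subgroups of `K` that belong to `F`. -/
def IsInjector {G : Type*} [Group G] (F : Set (Subgroup G)) (V : Subgroup G) : Prop :=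
  ∀ K : Subgroup G, K.IsSubnormal → Maximal (fun S : Subgroup G => S ≤ K ∧ S ∈ F) (V ⊓ K)

/-- The set `F_N` of all members of `F` contained in `N`, viewed as subgroups of the group `N`. -/
def traceSet {G : Type*} [Group G] (F : Set (Subgroup G)) (N : Subgroup G) : Set (Subgroup N) :=
  {S : Subgroup N | S.map N.subtype ∈ F}

/-! Call `π` and the singletons `{p}` with `p ∉ π` blocks; distinct blocks are disjoint. In a
`π'`-soluble group every nontrivial section has a nontrivial quotient that is a `σ`-group for some
block `σ` (`blockSeparable_of_isPiSoluble`), and this passes to all subgroups. Hence Hall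
`σ`-subgroups exist and dominate the `σ`-subgroups, for every block `σ`
(`BlockSeparable.hasHall_of_isBlock`).

Of the Fitting set only two kinds of closure are used (`FittingClosed`): for normal subgroups and,
when `|π| ≥ 2`, for subgroups containing a normal subgroup of `π`-index. They imply that if `W ∈ F`
is normal in `H` with `H / W` a `σ`-group, then one member of `F` between `W` and `H` contains all
the others (`FittingClosed.exists_greatest`). Now let `H / M` be a `σ`-group and `W` be `F`-maximal
in `M`. Members of `F` in `H` above `W` normalize `W` and are `σ`-groups modulo `W`, so Hall's
theorem in `N_H(W) / W` conjugates them into any `F`-maximal subgroup above `W`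
(`FMax.exists_conj_smul_le`).

Injectors are built by induction (`injectorTheory`): an `F`-maximal subgroup of `H` above an
injector of `M` is an injector of `H`. The hard point is its behaviour on a second normal subgroup
`M'` whose quotient belongs to a different block. There one needs a single member of `F` containing
conjugates of given `F`-maximal subgroups of `M` and of `M'` (`exists_mem_conj_smul_le`).

Conjugation inside the residual follows from Frattini arguments giving `G = N_G(V) G^{𝔑^π}`. For a
Dnormal `N` one finds `K` normal in `G`, of `π`-index and normalizing `N`, and passes from `G` to
`KN` and then to its normal subgroup `N`. -/

namespace Subgroup

/-! ### Relative normality and indices inside a fixed ambient group. -/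

variable {G : Type*} [Group G]

/-- `M` is a normal subgroup of the subgroup `H` of the ambient group. -/
def NormalIn (M H : Subgroup G) : Prop := M ≤ H ∧ H ≤ normalizer (M : Set G)

theorem mem_normalizer_iff_conj_smul_eq {H : Subgroup G} {g : G} :
    g ∈ normalizer (H : Set G) ↔ MulAut.conj g • H = H :=
  (conjAct_pointwise_smul_iff (H := H) (g := g)).symm

theorem le_normalizer_iff_conj_smul_eq {H M : Subgroup G} :
    H ≤ normalizer (M : Set G) ↔ ∀ h ∈ H, MulAut.conj h • M = M :=
  ⟨fun h _ hx => mem_normalizer_iff_conj_smul_eq.1 (h hx),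
    fun h x hx => mem_normalizer_iff_conj_smul_eq.2 (h x hx)⟩

theorem conj_mul_smul (g h : G) (S : Subgroup G) :
    MulAut.conj (g * h) • S = MulAut.conj g • MulAut.conj h • S := by
  rw [map_mul, mul_smul]

theorem conj_inv_smul_smul (g : G) (S : Subgroup G) :
    MulAut.conj g⁻¹ • MulAut.conj g • S = S := by
  rw [← conj_mul_smul]; simp

theorem conj_smul_inv_smul (g : G) (S : Subgroup G) :
    MulAut.conj g • MulAut.conj g⁻¹ • S = S := by
  rw [← conj_mul_smul]; simp

theorem conj_smul_le_iff {g : G} {S T : Subgroup G} :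
    MulAut.conj g • S ≤ T ↔ S ≤ MulAut.conj g⁻¹ • T := by
  rw [map_inv]; exact pointwise_smul_subset_iff

theorem conj_smul_mono {g : G} {S T : Subgroup G} (h : S ≤ T) :
    MulAut.conj g • S ≤ MulAut.conj g • T :=
  pointwise_smul_le_pointwise_smul_iff.2 h

theorem conj_mem_conj_smul {g x : G} {S : Subgroup G} (h : x ∈ S) :
    g * x * g⁻¹ ∈ MulAut.conj g • S :=
  smul_mem_pointwise_smul x (MulAut.conj g) S h

theorem mem_conj_smul_iff {g x : G} {S : Subgroup G} :
    x ∈ MulAut.conj g • S ↔ g⁻¹ * x * g ∈ S := by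
  rw [mem_pointwise_smul_iff_inv_smul_mem, ← map_inv]
  simp [MulAut.smul_def]

theorem card_conj_smul (g : G) (S : Subgroup G) :
    Nat.card (MulAut.conj g • S : Subgroup G) = Nat.card S :=
  (Nat.card_congr (equivSMul (MulAut.conj g) S).toEquiv).symm

theorem conj_smul_sup (g : G) (S T : Subgroup G) :
    MulAut.conj g • (S ⊔ T) = MulAut.conj g • S ⊔ MulAut.conj g • T :=
  smul_sup _ _ _

theorem conj_smul_inf (g : G) (S T : Subgroup G) :
    MulAut.conj g • (S ⊓ T) = MulAut.conj g • S ⊓ MulAut.conj g • T :=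
  smul_inf _ _ _

theorem conj_smul_le_of_mem {g : G} {S T : Subgroup G} (h : S ≤ T) (hg : g ∈ T) :
    MulAut.conj g • S ≤ T :=
  conj_smul_le_of_le h ⟨g, hg⟩

theorem eq_of_le_of_natCard_le [Finite G] {S T : Subgroup G} (h : S ≤ T)
    (hc : Nat.card T ≤ Nat.card S) : S = T :=
  eq_of_le_of_card_ge h hc

theorem natCard_lt_of_lt [Finite G] {S T : Subgroup G} (h : S < T) : Nat.card S < Nat.card T := by
  by_contra hc
  exact h.ne (eq_of_le_of_natCard_le h.le (not_lt.1 hc))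

theorem natCard_mono [Finite G] {S T : Subgroup G} (h : S ≤ T) : Nat.card S ≤ Nat.card T :=
  card_le_of_le h

theorem exists_mul_of_mem_sup {A B : Subgroup G} (h : A ≤ normalizer (B : Set G)) {x : G}
    (hx : x ∈ A ⊔ B) : ∃ a ∈ A, ∃ b ∈ B, x = a * b := by
  have : x ∈ ((A ⊔ B : Subgroup G) : Set G) := hx
  rw [coe_mul_of_left_le_normalizer_right A B h] at this
  obtain ⟨a, ha, b, hb, rfl⟩ := this
  exact ⟨a, ha, b, hb, rfl⟩

/-- The second isomorphism theorem for indices. -/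
theorem relIndex_sup_of_le_normalizer {H K : Subgroup G} (h : H ≤ normalizer (K : Set G)) :
    K.relIndex (H ⊔ K) = K.relIndex H := by
  let N := normalizer (K : Set G)
  have hK : K ≤ N := le_normalizer
  have := relIndex_sup_right (H := H.subgroupOf N) (K := K.subgroupOf N)
  rw [← subgroupOf_sup h hK, relIndex_subgroupOf h, relIndex_subgroupOf (sup_le h hK)] at this
  exact this

namespace NormalIn

variable {M M' H K : Subgroup G}

theorem rfl' : NormalIn H H := ⟨le_rfl, le_normalizer⟩

theorem conj_eq (h : NormalIn M H) {x : G} (hx : x ∈ H) : MulAut.conj x • M = M :=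
  le_normalizer_iff_conj_smul_eq.1 h.2 x hx

theorem conj_mem (h : NormalIn M H) {x m : G} (hx : x ∈ H) (hm : m ∈ M) : x * m * x⁻¹ ∈ M :=
  ((h.2 hx) m).1 hm

theorem mono (h : NormalIn M H) (hMK : M ≤ K) (hKH : K ≤ H) : NormalIn M K :=
  ⟨hMK, hKH.trans h.2⟩

theorem of_conj_mem (h : M ≤ H) (h' : ∀ x ∈ H, ∀ m ∈ M, x * m * x⁻¹ ∈ M) : NormalIn M H :=
  ⟨h, le_normalizer_iff.2 h'⟩

theorem of_conj_smul_le (h : M ≤ H) (h' : ∀ x ∈ H, MulAut.conj x • M ≤ M) : NormalIn M H :=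
  of_conj_mem h fun x hx _ hm => h' x hx (conj_mem_conj_smul hm)

theorem inf_right (h : NormalIn M H) (hK : K ≤ H) : NormalIn (M ⊓ K) K :=
  of_conj_mem inf_le_right fun _ hx _ hm =>
    ⟨h.conj_mem (hK hx) hm.1, K.mul_mem (K.mul_mem hx hm.2) (K.inv_mem hx)⟩

theorem inf_left (h : NormalIn M H) (hK : K ≤ H) : NormalIn (K ⊓ M) K :=
  inf_comm K M ▸ h.inf_right hK

theorem inf (h : NormalIn M H) (h' : NormalIn M' H) : NormalIn (M ⊓ M') H :=
  of_conj_mem (inf_le_left.trans h.1) fun _ hx _ hm =>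
    ⟨h.conj_mem hx hm.1, h'.conj_mem hx hm.2⟩

theorem sup (h : NormalIn M H) (h' : NormalIn M' H) : NormalIn (M ⊔ M') H :=
  of_conj_smul_le (sup_le h.1 h'.1) fun x hx => by
    rw [conj_smul_sup, h.conj_eq hx, h'.conj_eq hx]

theorem conj (h : NormalIn M H) (g : G) :
    NormalIn (MulAut.conj g • M) (MulAut.conj g • H) :=
  of_conj_mem (conj_smul_mono h.1) fun x hx m hm => by
    rw [mem_conj_smul_iff] at hx hm ⊢
    have := h.conj_mem hx hm
    convert this using 1
    group

theorem sup_of_le (h : K ≤ normalizer (M : Set G)) : NormalIn M (K ⊔ M) :=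
  ⟨le_sup_right, sup_le h le_normalizer⟩

theorem bot : NormalIn (⊥ : Subgroup G) H :=
  of_conj_mem bot_le fun x _ m hm => by rw [mem_bot] at hm ⊢; simp [hm]

theorem top_iff : NormalIn M (⊤ : Subgroup G) ↔ M.Normal := by
  constructor
  · intro h; exact normalizer_eq_top_iff.1 (top_le_iff.1 h.2)
  · intro h; exact ⟨le_top, (normalizer_eq_top_iff.2 h).ge⟩

theorem subgroupOf_normal (h : NormalIn M H) : (M.subgroupOf H).Normal :=
  (normal_subgroupOf_iff_le_normalizer h.1).2 h.2

theorem iff_subgroupOf (h : M ≤ H) : NormalIn M H ↔ (M.subgroupOf H).Normal :=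
  ⟨fun h => h.subgroupOf_normal, fun h' => ⟨h, (normal_subgroupOf_iff_le_normalizer h).1 h'⟩⟩

theorem commutator (h : NormalIn M H) : NormalIn ⁅M, M⁆ H := by
  refine NormalIn.of_conj_smul_le (commutator_le_self M |>.trans h.1) fun y hy => ?_
  have : MulAut.conj y • ⁅M, M⁆ = ⁅MulAut.conj y • M, MulAut.conj y • M⁆ := map_commutator M M _
  rw [this, h.conj_eq hy]

end NormalIn

/-- `n` is a `σ`-number: all its prime divisors lie in `σ`. -/
def IsPiNumber (σ : Set Nat.Primes) (n : ℕ) : Prop := ∀ p : Nat.Primes, (p : ℕ) ∣ n → p ∈ σ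

namespace IsPiNumber

variable {σ τ : Set Nat.Primes} {m n : ℕ}

theorem of_dvd (h : IsPiNumber σ n) (hd : m ∣ n) : IsPiNumber σ m := fun p hp => h p (hp.trans hd)

theorem mul (h : IsPiNumber σ m) (h' : IsPiNumber σ n) : IsPiNumber σ (m * n) := fun p hp =>
  (p.2.dvd_mul.1 hp).elim (h p) (h' p)

theorem one : IsPiNumber σ 1 := fun p hp => absurd (Nat.dvd_one.1 hp) p.2.one_lt.ne'

theorem mono (h : IsPiNumber σ n) (hs : σ ⊆ τ) : IsPiNumber τ n := fun p hp => hs (h p hp)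

theorem coprime (hd : Disjoint σ τ) (h : IsPiNumber σ m) (h' : IsPiNumber τ n) : m.Coprime n := by
  refine Nat.coprime_of_dvd fun p hp h1 h2 => ?_
  exact Set.disjoint_left.1 hd (h ⟨p, hp⟩ h1) (h' ⟨p, hp⟩ h2)

theorem eq_one (hd : Disjoint σ τ) (h : IsPiNumber σ n) (h' : IsPiNumber τ n) : n = 1 :=
  (Nat.coprime_self n).1 (coprime hd h h')

end IsPiNumber

/-- The index of `A` in `B` is a `σ`-number. -/
def PiIndex (σ : Set Nat.Primes) (A B : Subgroup G) : Prop := IsPiNumber σ (A.relIndex B)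

namespace PiIndex

variable {σ τ : Set Nat.Primes} {A B C M H V : Subgroup G}

theorem trans (hAB : A ≤ B) (hBC : B ≤ C) (h : PiIndex σ A B) (h' : PiIndex σ B C) :
    PiIndex σ A C := by
  unfold PiIndex; rw [← relIndex_mul_relIndex A B C hAB hBC]; exact h.mul h'

theorem left (hAB : A ≤ B) (hBC : B ≤ C) (h : PiIndex σ A C) : PiIndex σ A B :=
  h.of_dvd (by rw [← relIndex_mul_relIndex A B C hAB hBC]; exact dvd_mul_right _ _)

theorem right (hAB : A ≤ B) (h : PiIndex σ A C) : PiIndex σ B C :=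
  h.of_dvd (relIndex_dvd_of_le_left C hAB)

theorem inf_right : PiIndex σ (A ⊓ B) B ↔ PiIndex σ A B := by
  unfold PiIndex; rw [inf_relIndex_right]

theorem inf_left : PiIndex σ (B ⊓ A) B ↔ PiIndex σ A B := by
  unfold PiIndex; rw [inf_relIndex_left]

theorem sup_iff (h : H ≤ normalizer (M : Set G)) : PiIndex σ M (H ⊔ M) ↔ PiIndex σ M H := by
  unfold PiIndex; rw [relIndex_sup_of_le_normalizer h]

theorem restrict (hM : NormalIn M H) (hV : V ≤ H) (h : PiIndex σ M H) : PiIndex σ M V :=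
  (sup_iff (hV.trans hM.2)).1 (h.left le_sup_right (sup_le hV hM.1))

theorem conj (h : PiIndex σ A B) (g : G) :
    PiIndex σ (MulAut.conj g • A) (MulAut.conj g • B) := by
  unfold PiIndex; rw [relIndex_pointwise_smul]; exact h

theorem refl : PiIndex σ A A := by unfold PiIndex; rw [relIndex_self]; exact IsPiNumber.one

theorem mono (h : PiIndex σ A B) (hs : σ ⊆ τ) : PiIndex τ A B := IsPiNumber.mono h hs

theorem le (hd : Disjoint σ τ) (h : PiIndex σ A B) (h' : PiIndex τ A B) : B ≤ A :=
  relIndex_eq_one.1 (IsPiNumber.eq_one hd h h')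

theorem inf_normalIn (hM : NormalIn M H) (hV : V ≤ H) (h : PiIndex σ M H) (h' : PiIndex σ V H) :
    PiIndex σ (M ⊓ V) H :=
  trans inf_le_right hV (inf_right.2 (h.restrict hM hV)) h'

end PiIndex

theorem card_eq_card_mul_relIndex {A B : Subgroup G} (h : A ≤ B) :
    Nat.card A * A.relIndex B = Nat.card B := by
  rw [← relIndex_bot_left, ← relIndex_bot_left, relIndex_mul_relIndex _ _ _ bot_le h]

end Subgroup

/-! ### Blocks of primes and block separable groups. -/

namespace Subgroup

variable {G : Type*} [Group G]

theorem exists_least_piIndex [Finite G] (σ : Set Nat.Primes) {U L : Subgroup G} (hU : U ≤ L) :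
    ∃ R, (U ≤ R ∧ NormalIn R L ∧ PiIndex σ R L) ∧
      ∀ S, U ≤ S → NormalIn S L → PiIndex σ S L → R ≤ S := by
  obtain ⟨R, hR⟩ := (Set.toFinite {R | U ≤ R ∧ NormalIn R L ∧ PiIndex σ R L}).exists_minimal
    ⟨L, hU, NormalIn.rfl', PiIndex.refl⟩
  refine ⟨R, hR.prop, fun S h1 h2 h3 => ?_⟩
  have := hR.le_of_le (y := R ⊓ S) ⟨le_inf hR.prop.1 h1, hR.prop.2.1.inf h2,
    PiIndex.inf_normalIn hR.prop.2.1 h2.1 hR.prop.2.2 h3⟩ inf_le_left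
  exact this.trans inf_le_right

/-- The conjugate of `R` satisfies the conditions for which `R` is least. -/
theorem le_conj_smul_of_least {σ : Set Nat.Primes} {U L R : Subgroup G}
    (hR : U ≤ R ∧ NormalIn R L ∧ PiIndex σ R L)
    (hmin : ∀ S, U ≤ S → NormalIn S L → PiIndex σ S L → R ≤ S) {g : G}
    (hgU : MulAut.conj g • U = U) (hgL : MulAut.conj g • L = L) : R ≤ MulAut.conj g • R := by
  refine hmin _ ?_ ?_ ?_
  · rw [← hgU]; exact conj_smul_mono hR.1
  · have := hR.2.1.conj g; rwa [hgL] at this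
  · have := hR.2.2.conj g; rwa [hgL] at this

/-- The smallest normal subgroup of `L` containing `U` with index a `σ`-number is invariant under
everything normalizing `U` and `L`. -/
theorem exists_least_piIndex_normalIn [Finite G] (σ : Set Nat.Primes) {U L Y : Subgroup G}
    (hUL : U ≤ L) (hU : NormalIn U Y) (hL : NormalIn L Y) :
    ∃ R, U ≤ R ∧ NormalIn R Y ∧ R ≤ L ∧ PiIndex σ R L ∧
      ∀ S, U ≤ S → NormalIn S L → PiIndex σ S L → R ≤ S := by
  obtain ⟨R, hR, hmin⟩ := exists_least_piIndex σ hUL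
  refine ⟨R, hR.1, NormalIn.of_conj_smul_le (hR.2.1.1.trans hL.1) fun y hy => ?_, hR.2.1.1,
    hR.2.2, hmin⟩
  rw [conj_smul_le_iff]
  have hy' := inv_mem hy
  exact le_conj_smul_of_least hR hmin (hU.conj_eq hy') (hL.conj_eq hy')

/-- The blocks of the partition of the set of primes given by `π` and the primes outside `π`. -/
def IsBlock (π σ : Set Nat.Primes) : Prop := σ = π ∨ ∃ p, p ∉ π ∧ σ = {p}

theorem IsBlock.disjoint {π σ τ : Set Nat.Primes} (hσ : IsBlock π σ) (hτ : IsBlock π τ)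
    (h : σ ≠ τ) : Disjoint σ τ := by
  rcases hσ with rfl | ⟨p, hp, rfl⟩ <;> rcases hτ with rfl | ⟨q, hq, rfl⟩
  · exact absurd rfl h
  · exact Set.disjoint_singleton_right.2 hq
  · exact Set.disjoint_singleton_left.2 hp
  · rw [Set.disjoint_singleton]; rintro rfl; exact h rfl

/-- Every section `T / U` of `H` which is nontrivial has a nontrivial quotient which is a
`σ`-group for a block `σ`. -/
def BlockSeparable (π : Set Nat.Primes) (H : Subgroup G) : Prop :=
  ∀ U T : Subgroup G, U < T → T ≤ H → NormalIn U T →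
    ∃ R σ, IsBlock π σ ∧ U ≤ R ∧ R < T ∧ NormalIn R T ∧ PiIndex σ R T

variable {π : Set Nat.Primes}

theorem BlockSeparable.mono {H K : Subgroup G} (h : BlockSeparable π H) (hK : K ≤ H) :
    BlockSeparable π K := fun U T h1 h2 h3 => h U T h1 (h2.trans hK) h3

theorem BlockSeparable.exists_normalIn [Finite G] {U L Y : Subgroup G} (h : BlockSeparable π L)
    (hUL : U < L) (hU : NormalIn U Y) (hL : NormalIn L Y) :
    ∃ R σ, IsBlock π σ ∧ U ≤ R ∧ R < L ∧ NormalIn R Y ∧ PiIndex σ R L := by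
  obtain ⟨R, σ, hσ, h1, h2, h3, h4⟩ := h U L hUL le_rfl (hU.mono hUL.le hL.1)
  obtain ⟨R', h1', h2', h3', h4', h5'⟩ := exists_least_piIndex_normalIn σ hUL.le hU hL
  exact ⟨R', σ, hσ, h1', (h5' R h1 h3 h4).trans_lt h2, h2', h4'⟩

/-- For a section `T / U`, either `U(T ∩ M) < T`, and this subgroup has `σ`-index, or `T = U(T ∩
M)`. In the second case `T / U ≅ (T ∩ M) / (U ∩ M)` is isomorphic to a section of `M`, and the
subgroup `R` found there is carried to `UR`. -/
theorem blockSeparable_of_normalIn {H M : Subgroup G} (hM : NormalIn M H)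
    (hs : BlockSeparable π M) {σ : Set Nat.Primes} (hσ : IsBlock π σ) (hi : PiIndex σ M H) :
    BlockSeparable π H := by
  intro U T hUT hTH hU
  have hT0 : NormalIn (T ⊓ M) T := hM.inf_left hTH
  have hN : NormalIn (U ⊔ T ⊓ M) T := hU.sup hT0
  by_cases hlt : U ⊔ T ⊓ M < T
  · refine ⟨_, σ, hσ, le_sup_left, hlt, hN, ?_⟩
    exact PiIndex.right le_sup_right (PiIndex.inf_left.2 (hi.restrict hM hTH))
  · have heq : U ⊔ T ⊓ M = T := hN.1.eq_of_not_lt hlt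
    have hUN : T ⊓ M ≤ normalizer (U : Set G) := inf_le_left.trans hU.2
    have hlt' : U ⊓ (T ⊓ M) < T ⊓ M := by
      refine inf_le_right.lt_of_ne fun h => ?_
      rw [inf_eq_right] at h
      rw [sup_eq_left.2 h] at heq
      exact hUT.ne heq
    obtain ⟨R, τ, hτ, h1, h2, h3, h4⟩ := hs _ _ hlt' inf_le_right (hU.inf_right inf_le_left)
    have hRT : R ≤ T := h2.le.trans inf_le_left
    have hRU : R ≤ normalizer (U : Set G) := hRT.trans hU.2
    have hTN : T ⊓ M ≤ normalizer ((U ⊔ R : Subgroup G) : Set G) :=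
      (le_inf hUN h3.2).trans (normalizer_inf_normalizer_le_normalizer_sup U R)
    have hnor : NormalIn (U ⊔ R) T := by
      refine ⟨sup_le hU.1 hRT, ?_⟩
      rw [← heq]
      exact sup_le (le_sup_left.trans le_normalizer) (heq.symm ▸ hTN)
    have hinf : (U ⊔ R) ⊓ (T ⊓ M) = R := by
      refine le_antisymm ?_ (le_inf le_sup_right h2.le)
      rintro x ⟨hx, hxT⟩
      rw [SetLike.mem_coe, sup_comm] at hx
      obtain ⟨r, hr, u, hu, rfl⟩ := exists_mul_of_mem_sup hRU hx
      have hu' : u ∈ T ⊓ M := by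
        have := mul_mem (inv_mem (h2.le hr)) hxT; simpa using this
      exact mul_mem hr (h1 ⟨hu, hu'⟩)
    refine ⟨U ⊔ R, τ, hτ, le_sup_left, hnor.1.lt_of_ne fun h => h2.ne ?_, hnor, ?_⟩
    · rw [← hinf, h, inf_eq_right.2 inf_le_left]
    · have : T ⊓ M ⊔ (U ⊔ R) = T := le_antisymm (sup_le inf_le_left hnor.1) (by
        conv_lhs => rw [← heq]
        exact sup_le (le_sup_left.trans le_sup_right) le_sup_left)
      rw [← this, PiIndex.sup_iff hTN, ← PiIndex.inf_right, hinf]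
      exact h4

theorem blockSeparable_bot : BlockSeparable π (⊥ : Subgroup G) := fun _ _ h h' _ =>
  absurd (h.trans_le h') not_lt_bot

end Subgroup

/-! ### From composition factors to blocks. -/

namespace Subgroup

variable {G : Type*} [Group G] {π : Set Nat.Primes}

theorem _root_.IsPGroup.isPiNumber_card {Q : Type*} [Group Q] [Finite Q] {p : Nat.Primes}
    (h : IsPGroup (p : ℕ) Q) : IsPiNumber {p} (Nat.card Q) := by
  intro q hq
  have : Fact (p : ℕ).Prime := ⟨p.2⟩
  obtain ⟨n, hn⟩ := IsPGroup.iff_card.1 h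
  rw [hn] at hq
  exact Subtype.ext ((Nat.prime_dvd_prime_iff_eq q.2 p.2).1 (q.2.dvd_of_dvd_pow hq))

theorem IsPiNumber.isPGroup {Q : Type*} [Group Q] [Finite Q] {p : Nat.Primes}
    (h : IsPiNumber {p} (Nat.card Q)) : IsPGroup (p : ℕ) Q := by
  refine IsPGroup.of_card (Nat.eq_prime_pow_of_unique_prime_dvd Nat.card_pos.ne' ?_)
  intro d hd hdvd
  exact congrArg Subtype.val (h ⟨d, hd⟩ hdvd : (⟨d, hd⟩ : Nat.Primes) = p)

theorem exists_maximal_normalIn [Finite G] {H : Subgroup G} (hH : H ≠ ⊥) :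
    ∃ M, NormalIn M H ∧ M < H ∧ ∀ K, NormalIn K H → M ≤ K → K < H → K = M := by
  obtain ⟨M, hM⟩ := (Set.toFinite {M | NormalIn M H ∧ M < H}).exists_maximal
    ⟨⊥, NormalIn.bot, bot_lt_iff_ne_bot.2 hH⟩
  exact ⟨M, hM.prop.1, hM.prop.2, fun K h1 h2 h3 => le_antisymm (hM.le_of_ge ⟨h1, h3⟩ h2) h2⟩

theorem isSimpleGroup_quotient {M H : Subgroup G} [(M.subgroupOf H).Normal] (hlt : M < H)
    (hmax : ∀ K, NormalIn K H → M ≤ K → K < H → K = M) :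
    IsSimpleGroup (H ⧸ M.subgroupOf H) := by
  have : Nontrivial (H ⧸ M.subgroupOf H) := by
    rw [QuotientGroup.nontrivial_iff, Ne, subgroupOf_eq_top]
    exact hlt.not_ge
  refine ⟨fun N hN => ?_⟩
  set f := QuotientGroup.mk' (M.subgroupOf H)
  have hf : Function.Surjective f := QuotientGroup.mk'_surjective _
  set K := (N.comap f).map H.subtype with hK
  have hKs : K.subgroupOf H = N.comap f := comap_map_eq_self_of_injective H.subtype_injective _
  have hKH : K ≤ H := map_subtype_le _
  have hKn : NormalIn K H := by
    rw [NormalIn.iff_subgroupOf hKH, hKs]; exact hN.comap f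
  have hMK : M ≤ K := by
    intro x hx
    refine ⟨⟨x, hlt.le hx⟩, ?_, rfl⟩
    have : f ⟨x, hlt.le hx⟩ = 1 := (QuotientGroup.eq_one_iff _).2 hx
    rw [SetLike.mem_coe, mem_comap, this]
    exact one_mem N
  have hN' : N = (K.subgroupOf H).map f := by rw [hKs, map_comap_eq_self_of_surjective hf]
  by_cases h : K < H
  · left
    rw [hN', hmax K hKn hMK h, map_eq_bot_iff, QuotientGroup.ker_mk']
  · right
    rw [hN', hKH.eq_of_not_lt h, subgroupOf_self, map_top_of_surjective f hf]

/-- Induction down a composition series: for `M` maximal normal in `H`, the factor `H / M` is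
simple, hence a `π`-group or a `p`-group with `p ∉ π`. -/
theorem blockSeparable_of_isSubnormal [Finite G] (hG : IsPiSoluble πᶜ G) (H : Subgroup G)
    (hH : H.IsSubnormal) : BlockSeparable π H := by
  induction hn : Nat.card H using Nat.strong_induction_on generalizing H with
  | _ n ih =>
    by_cases hb : H = ⊥
    · rw [hb]; exact blockSeparable_bot
    obtain ⟨M, hM, hlt, hmax⟩ := exists_maximal_normalIn hb
    have := hM.subgroupOf_normal
    have hMs : M.IsSubnormal := .step M H hM.1 hH this
    have hs := isSimpleGroup_quotient hlt hmax
    have hIH := ih _ (hn ▸ natCard_lt_of_lt hlt) M hMs rfl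
    have hcf : IsCompositionFactor H M := ⟨hH, hlt.le, hs⟩
    rcases hG.1 H M hcf with h | h
    · obtain ⟨p, hp, hpg⟩ := hG.2 H M hcf h
      exact blockSeparable_of_normalIn hM hIH (Or.inr ⟨p, hp, rfl⟩) hpg.isPiNumber_card
    · rw [compl_compl] at h
      exact blockSeparable_of_normalIn hM hIH (Or.inl rfl) h

theorem blockSeparable_of_isPiSoluble [Finite G] (hG : IsPiSoluble πᶜ G) (H : Subgroup G) :
    BlockSeparable π H :=
  (blockSeparable_of_isSubnormal hG ⊤ .top).mono le_top

end Subgroup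

/-! ### Schur–Zassenhaus with abelian kernel, and Hall subgroups modulo a normal subgroup. -/

namespace Subgroup

section Complements

variable {X : Type*} [Group X] [Finite X]

/-- A complement is itself a transversal of `R` and fixes its own class in `R.QuotientDiff`;
comparing orders, it is the full stabilizer of that class. Since `R` acts transitively on the
classes, the stabilizers are conjugate under `R`. -/
theorem exists_conj_smul_eq_of_isComplement' {R S T : Subgroup X} [R.Normal] [IsMulCommutative R]
    (hc : Nat.Coprime (Nat.card R) R.index) (hS : IsComplement' R S) (hT : IsComplement' R T) :
    ∃ r ∈ R, MulAut.conj r • S = T := by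
  have key : ∀ {S : Subgroup X}, IsComplement' R S → ∃ α : R.QuotientDiff,
      MulAction.stabilizer X α = S := by
    intro S hS
    let β : R.LeftTransversal := ⟨(S : Set X), hS.symm⟩
    let α : R.QuotientDiff := Quotient.mk'' β
    refine ⟨α, ?_⟩
    have hle : S ≤ MulAction.stabilizer X α := by
      intro s hs
      rw [MulAction.mem_stabilizer_iff]
      refine congrArg Quotient.mk'' (Subtype.ext ?_ : MulOpposite.op s⁻¹ • β = β)
      change MulOpposite.op s⁻¹ • (S : Set X) = S
      exact op_smul_coe_set (inv_mem hs)
    have h1 := (isComplement'_stabilizer_of_coprime (α := α) hc).card_mul_card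
    have h2 := hS.card_mul_card
    refine (eq_of_le_of_natCard_le hle ?_).symm
    exact (Nat.eq_of_mul_eq_mul_left Nat.card_pos (h1.trans h2.symm)).le
  obtain ⟨α, hα⟩ := key hS
  obtain ⟨β, hβ⟩ := key hT
  obtain ⟨r, hr⟩ := exists_smul_eq hc α β
  refine ⟨r, r.2, ?_⟩
  have : (r : X) • α = β := hr
  rw [← hα, ← hβ, ← this, MulAction.stabilizer_smul_eq_stabilizer_map_conj]
  rfl

end Complements

/-- Over the normal subgroup `W` of `Y` there is a Hall `σ`-subgroup of `Y` into which every
`σ`-subgroup can be conjugated. -/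
def HasHall {G : Type*} [Group G] (σ : Set Nat.Primes) (W Y : Subgroup G) : Prop :=
  ∃ H, W ≤ H ∧ H ≤ Y ∧ PiIndex σ W H ∧ PiIndex σᶜ H Y ∧
    ∀ S, W ≤ S → S ≤ Y → PiIndex σ W S → ∃ y ∈ Y, MulAut.conj y • S ≤ H

theorem hasHall_singleton {X : Type*} [Group X] [Finite X] (p : Nat.Primes) :
    HasHall {p} (⊥ : Subgroup X) ⊤ := by
  have : Fact (p : ℕ).Prime := ⟨p.2⟩
  have P : Sylow (p : ℕ) X := default
  refine ⟨P, bot_le, le_top, ?_, ?_, fun S _ _ hS => ?_⟩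
  · unfold PiIndex; rw [relIndex_bot_left]; exact P.isPGroup'.isPiNumber_card
  · unfold PiIndex; rw [relIndex_top_right]
    intro q hq h
    rw [Set.mem_singleton_iff] at h; subst h
    exact P.not_dvd_index hq
  · unfold PiIndex at hS; rw [relIndex_bot_left] at hS
    obtain ⟨Q, hQ⟩ := hS.isPGroup.exists_le_sylow
    obtain ⟨x, hx⟩ := MulAction.exists_smul_eq X Q P
    refine ⟨x, mem_top x, ?_⟩
    rw [← hx]
    exact conj_smul_mono hQ

/-- A complement `C` of `R` is the Hall subgroup. For a `σ`-subgroup `S`, both `S` and `C ∩ SR` are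
complements of `R` in `SR`, so they are conjugate. -/
theorem hasHall_of_isMulCommutative {X : Type*} [Group X] [Finite X] {σ : Set Nat.Primes}
    {R : Subgroup X} [R.Normal] [IsMulCommutative R] (hR : IsPiNumber σᶜ (Nat.card R))
    (hRi : IsPiNumber σ R.index) : HasHall σ (⊥ : Subgroup X) ⊤ := by
  have hd : Disjoint σᶜ σ := disjoint_compl_left
  obtain ⟨C, hC⟩ := exists_right_complement'_of_coprime (hR.coprime hd hRi)
  refine ⟨C, bot_le, le_top, ?_, ?_, fun S _ _ hS => ?_⟩
  · unfold PiIndex; rw [relIndex_bot_left, ← hC.symm.index_eq_card]; exact hRi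
  · unfold PiIndex; rw [relIndex_top_right, hC.index_eq_card]; exact hR
  · unfold PiIndex at hS; rw [relIndex_bot_left] at hS
    have hSN : S ≤ normalizer (R : Set X) := le_normalizer_of_normal
    set Y := S ⊔ R
    have hRY : R ≤ Y := le_sup_right
    have hSY : S ≤ Y := le_sup_left
    have hcard : Nat.card (R.subgroupOf Y) = Nat.card R :=
      Nat.card_congr (subgroupOfEquivOfLe hRY).toEquiv
    have hidx : (R.subgroupOf Y).index ∣ R.index := relIndex_dvd_index_of_normal R Y
    have hcop : Nat.Coprime (Nat.card (R.subgroupOf Y)) (R.subgroupOf Y).index := by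
      rw [hcard]; exact hR.coprime hd (hRi.of_dvd hidx)
    have h1 : IsComplement' (R.subgroupOf Y) (S.subgroupOf Y) := by
      refine isComplement'_of_disjoint_and_mul_eq_univ ?_ (Set.eq_univ_of_forall ?_)
      · rw [disjoint_iff, eq_bot_iff]
        rintro x ⟨hx1, hx2⟩
        have hx : (x : X) ∈ R ⊓ S := ⟨hx1, hx2⟩
        rw [(disjoint_of_coprime_natCard (hR.coprime hd hS)).eq_bot, mem_bot] at hx
        exact Subtype.ext hx
      · rintro ⟨x, hx⟩
        obtain ⟨s, hs, r, hr, rfl⟩ := exists_mul_of_mem_sup hSN hx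
        refine ⟨⟨s * r * s⁻¹, hRY ?_⟩, ?_, ⟨s, hSY hs⟩, hs, Subtype.ext ?_⟩
        · exact Normal.conj_mem inferInstance r hr s
        · exact Normal.conj_mem (H := R) inferInstance r hr s
        · simp
    have h2 : IsComplement' (R.subgroupOf Y) (C.subgroupOf Y) := by
      refine isComplement'_of_disjoint_and_mul_eq_univ ?_ (Set.eq_univ_of_forall ?_)
      · rw [disjoint_iff, eq_bot_iff]
        rintro x ⟨hx1, hx2⟩
        have hx : (x : X) ∈ R ⊓ C := ⟨hx1, hx2⟩
        rw [hC.disjoint.eq_bot, mem_bot] at hx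
        exact Subtype.ext hx
      · rintro ⟨x, hx⟩
        obtain ⟨⟨⟨r, hr⟩, c⟩, he⟩ := hC.2 x
        have he : r * c = x := he
        have hc : (c : X) ∈ Y := by
          rw [← he] at hx
          simpa using mul_mem (inv_mem (hRY hr)) hx
        exact ⟨⟨r, hRY hr⟩, hr, ⟨c, hc⟩, c.2, Subtype.ext he⟩
    obtain ⟨r, -, hr⟩ := exists_conj_smul_eq_of_isComplement' hcop h1 h2
    refine ⟨r, mem_top _, ?_⟩
    rw [conj_smul_subgroupOf hSY] at hr
    have h3 : MulAut.conj (r : X) • S ≤ Y := conj_smul_le_of_mem hSY r.2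
    intro x hx
    exact hr.le (show (⟨x, h3 hx⟩ : Y) ∈ (MulAut.conj (r : X) • S).subgroupOf Y from hx)

section Transport

variable {G : Type*} [Group G] {σ : Set Nat.Primes} {W Y : Subgroup G}

theorem hasHall_of_quotient [Finite G] [(W.subgroupOf Y).Normal] (hWY : W ≤ Y)
    (h : HasHall σ (⊥ : Subgroup (Y ⧸ W.subgroupOf Y)) ⊤) : HasHall σ W Y := by
  set f := QuotientGroup.mk' (W.subgroupOf Y)
  have hf : Function.Surjective f := QuotientGroup.mk'_surjective _
  have hW : W.subgroupOf Y = comap f ⊥ := (QuotientGroup.ker_mk' _).symm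
  have hidx : ∀ S, S ≤ Y → W.relIndex S = (⊥ : Subgroup _).relIndex (map f (S.subgroupOf Y)) := by
    intro S hS
    rw [← relIndex_comap, ← hW, relIndex_subgroupOf hS]
  obtain ⟨H, -, -, h3, h4, h5⟩ := h
  have hL : (map Y.subtype (comap f H)).subgroupOf Y = comap f H :=
    comap_map_eq_self_of_injective Y.subtype_injective _
  refine ⟨map Y.subtype (comap f H), ?_, map_subtype_le _, ?_, ?_, fun S hS1 hS2 hS3 => ?_⟩
  · intro x hx
    refine ⟨⟨x, hWY hx⟩, ?_, rfl⟩
    exact comap_mono (f := f) (bot_le (a := H)) (hW.le hx)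
  · unfold PiIndex
    rw [hidx _ (map_subtype_le _), hL, map_comap_eq_self_of_surjective hf]
    exact h3
  · unfold PiIndex
    rw [relIndex, hL, index_comap_of_surjective H hf, ← relIndex_top_right]
    exact h4
  · unfold PiIndex at hS3
    rw [hidx S hS2] at hS3
    obtain ⟨y, -, hy⟩ := h5 _ bot_le le_top hS3
    obtain ⟨y, rfl⟩ := hf y
    refine ⟨y, y.2, ?_⟩
    rintro x hx
    rw [mem_conj_smul_iff] at hx
    have hxY : x ∈ Y := by
      have := mul_mem (mul_mem y.2 (hS2 hx)) (inv_mem y.2)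
      simpa [mul_assoc] using this
    refine ⟨⟨x, hxY⟩, ?_, rfl⟩
    apply hy
    rw [mem_conj_smul_iff]
    exact ⟨y⁻¹ * ⟨x, hxY⟩ * y, hx, by simp⟩

theorem hasHall_singleton_of_normalIn [Finite G] (h : NormalIn W Y) (p : Nat.Primes) :
    HasHall {p} W Y := by
  have := h.subgroupOf_normal
  exact hasHall_of_quotient h.1 (hasHall_singleton p)

/-- A subgroup `T` whose index in `Y` is a `σ'`-number contains conjugates of all
`σ`-subgroups. -/
theorem HasHall.exists_conj_smul_le [Finite G] {T S : Subgroup G} (hY : HasHall σ W Y)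
    (hT : HasHall σ W T) (hTY : T ≤ Y) (hi : PiIndex σᶜ T Y) (hW : NormalIn W Y)
    (hWS : W ≤ S) (hS : S ≤ Y) (hSi : PiIndex σ W S) : ∃ y ∈ Y, MulAut.conj y • S ≤ T := by
  obtain ⟨H, h1, h2, h3, h4, h5⟩ := hY
  obtain ⟨K, k1, k2, k3, k4, -⟩ := hT
  obtain ⟨y, hy, hy'⟩ := h5 K k1 (k2.trans hTY) k3
  obtain ⟨z, hz, hz'⟩ := h5 S hWS hS hSi
  have hWK : W ≤ MulAut.conj y • K := by
    rw [← hW.conj_eq hy]; exact conj_smul_mono k1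
  have hKi : PiIndex σᶜ (MulAut.conj y • K) Y := by
    have := (k4.trans k2 hTY hi).conj y
    rwa [conj_smul_eq_self_of_mem hy] at this
  have hHK : H ≤ MulAut.conj y • K :=
    PiIndex.le disjoint_compl_right (h3.right hWK) (hKi.left hy' h2)
  refine ⟨y⁻¹ * z, mul_mem (inv_mem hy) hz, ?_⟩
  rw [conj_mul_smul, conj_smul_le_iff, inv_inv]
  exact hz'.trans (hHK.trans (conj_smul_mono k2))

end Transport

end Subgroup

/-! ### Hall subgroups of block separable groups. -/

namespace Subgroup

variable {G : Type*} [Group G] [Finite G] {σ π : Set Nat.Primes} {W R Y : Subgroup G}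

theorem hasHall_of_commutator_le (hW : NormalIn W Y) (hR : NormalIn R Y)
    (hcomm : ⁅R, R⁆ ≤ W) (h1 : PiIndex σᶜ W R) (h2 : PiIndex σ R Y) : HasHall σ W Y := by
  have := hW.subgroupOf_normal
  refine hasHall_of_quotient hW.1 ?_
  set f := QuotientGroup.mk' (W.subgroupOf Y)
  have hf : Function.Surjective f := QuotientGroup.mk'_surjective _
  have hker : f.ker = W.subgroupOf Y := QuotientGroup.ker_mk' _
  have hn : ((R.subgroupOf Y).map f).Normal := hR.subgroupOf_normal.map f hf
  have hc : IsMulCommutative ((R.subgroupOf Y).map f) := by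
    rw [← le_centralizer_iff_isMulCommutative, ← commutator_eq_bot_iff_le_centralizer,
      ← map_commutator, map_eq_bot_iff, hker]
    intro x hx
    have : Y.subtype x ∈ map Y.subtype ⁅R.subgroupOf Y, R.subgroupOf Y⁆ := mem_map_of_mem _ hx
    rw [map_commutator, subgroupOf_map_subtype, inf_eq_left.2 hR.1] at this
    exact hcomm this
  refine hasHall_of_isMulCommutative (R := (R.subgroupOf Y).map f) ?_ ?_
  · rw [← relIndex_ker, hker, relIndex_subgroupOf hR.1]
    exact h1
  · exact IsPiNumber.of_dvd h2 (index_map_dvd _ hf)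

/-- A nontrivial finite `p`-group is nilpotent, hence not perfect. -/
theorem commutator_sup_lt {p : Nat.Primes} (hW : NormalIn W R) (hlt : W < R)
    (hi : PiIndex {p} W R) : ⁅R, R⁆ ⊔ W < R := by
  refine (sup_le (commutator_le_self R) hW.1).lt_of_ne fun h => ?_
  have := hW.subgroupOf_normal
  have : Fact (p : ℕ).Prime := ⟨p.2⟩
  set Q := R ⧸ W.subgroupOf R
  set f := QuotientGroup.mk' (W.subgroupOf R)
  have hf : Function.Surjective f := QuotientGroup.mk'_surjective _
  have hQ : IsPGroup (p : ℕ) Q := IsPiNumber.isPGroup hi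
  have : Group.IsNilpotent Q := hQ.isNilpotent
  have : Nontrivial Q := by
    rw [QuotientGroup.nontrivial_iff, Ne, subgroupOf_eq_top]
    exact hlt.not_ge
  refine (Group.IsSolvable.commutator_lt_top_of_nontrivial Q).ne ?_
  have h1 : ⁅(⊤ : Subgroup R), ⊤⁆ ⊔ W.subgroupOf R = ⊤ := by
    apply map_injective R.subtype_injective
    rw [map_sup, map_commutator, subgroupOf_map_subtype, inf_eq_left.2 hW.1, ← MonoidHom.range_eq_map,
      range_subtype, h]
  have h2 := congrArg (map f) h1
  rw [map_sup, map_commutator, map_top_of_surjective f hf] at h2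
  have h3 : map f (W.subgroupOf R) = ⊥ := by rw [map_eq_bot_iff, QuotientGroup.ker_mk']
  rw [h3, sup_bot_eq] at h2
  exact h2

/-- Induction on `|Y : W|` through a minimal normal subgroup `R / W` of `Y / W`, which is a
`τ`-group for a block `τ`. A Hall subgroup `H / R` of `Y / R` works already if `τ = π`. If `τ =
{p}`, then `R / W` is abelian; either `H < Y` and induction applies to `H`, or `H = Y` and the
abelian complement theorem applies. -/
theorem BlockSeparable.hasHall (hY : BlockSeparable π Y) (hW : NormalIn W Y) :
    HasHall π W Y := by
  induction hn : W.relIndex Y using Nat.strong_induction_on generalizing W Y with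
  | _ n ih =>
    subst hn
    by_cases hWY : W = Y
    · subst hWY
      exact ⟨W, le_rfl, le_rfl, .refl, .refl, fun S _ h _ => ⟨1, one_mem _, by simpa using h⟩⟩
    have hlt : W < Y := hW.1.lt_of_ne hWY
    obtain ⟨R, hR⟩ := (Set.toFinite {R | W < R ∧ NormalIn R Y}).exists_minimal
      ⟨Y, hlt, NormalIn.rfl'⟩
    -- Minimality of `R / W` is used twice: it forces the block quotient of `R / W` to be `R / W`
    -- itself, and it makes a `p`-group `R / W` abelian.
    obtain ⟨⟨hWR, hRY⟩, hmin⟩ := hR.prop, fun S (h : W < S ∧ NormalIn S Y) => hR.le_of_le h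
    have hmin : ∀ S, W ≤ S → S < R → NormalIn S Y → S = W := by
      intro S h1 h2 h3
      by_contra h
      exact h2.not_ge (hmin S ⟨h1.lt_of_ne (Ne.symm h), h3⟩ h2.le)
    obtain ⟨R', τ, hτ, r1, r2, r3, r4⟩ := (hY.mono hRY.1).exists_normalIn hWR hW hRY
    obtain rfl := hmin R' r1 r2 r3
    have hpos : ∀ A B : Subgroup G, 0 < A.relIndex B := fun A B =>
      Nat.pos_of_ne_zero index_ne_zero_of_finite
    have hlt1 : R.relIndex Y < R'.relIndex Y := by
      rw [← relIndex_mul_relIndex R' R Y hWR.le hRY.1]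
      have h1 : R'.relIndex R ≠ 1 := fun h => hWR.not_ge (relIndex_eq_one.1 h)
      have := hpos R' R
      exact lt_mul_of_one_lt_left (hpos R Y) (by omega)
    obtain ⟨H, h1, h2, h3, h4, h5⟩ := ih _ hlt1 hY hRY rfl
    have hconj : ∀ S, R' ≤ S → S ≤ Y → PiIndex π R' S → ∃ y ∈ Y, MulAut.conj y • S ≤ H := by
      intro S s1 s2 s3
      obtain ⟨y, hy, hy'⟩ := h5 (S ⊔ R) le_sup_right (sup_le s2 hRY.1)
        ((PiIndex.sup_iff (s2.trans hRY.2)).2 (s3.right hWR.le))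
      exact ⟨y, hy, (conj_smul_mono le_sup_left).trans hy'⟩
    rcases hτ with rfl | ⟨p, hp, rfl⟩
    · exact ⟨H, hWR.le.trans h1, h2, r4.trans hWR.le h1 h3, h4, hconj⟩
    have hcomm : ⁅R, R⁆ ≤ R' := by
      have := hmin _ le_sup_right (commutator_sup_lt (r3.mono hWR.le hRY.1) hWR r4)
        (hRY.commutator.sup r3)
      exact le_sup_left.trans this.le
    have r5 : PiIndex πᶜ R' R := r4.mono (by simpa using hp)
    by_cases hHY : H = Y
    · subst hHY
      exact hasHall_of_commutator_le r3 hRY hcomm r5 h3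
    · have hlt2 : R'.relIndex H < R'.relIndex Y := by
        rw [← relIndex_mul_relIndex R' H Y (hWR.le.trans h1) h2]
        have h1 : H.relIndex Y ≠ 1 := fun h =>
          (h2.lt_of_ne hHY).not_ge (relIndex_eq_one.1 h)
        have := hpos H Y
        exact lt_mul_of_one_lt_right (hpos R' H) (by omega)
      have hn := r3.mono (hWR.le.trans h1) h2
      obtain ⟨K, k1, k2, k3, k4, k5⟩ := ih _ hlt2 (hY.mono h2) hn rfl
      refine ⟨K, k1, k2.trans h2, k3, k4.trans k2 h2 h4, fun S s1 s2 s3 => ?_⟩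
      obtain ⟨y, hy, hy'⟩ := hconj S s1 s2 s3
      have e1 : R' ≤ MulAut.conj y • S := by
        rw [← r3.conj_eq hy]; exact conj_smul_mono s1
      have e2 : PiIndex π R' (MulAut.conj y • S) := by
        have := s3.conj y; rwa [r3.conj_eq hy] at this
      obtain ⟨z, hz, hz'⟩ := k5 _ e1 hy' e2
      exact ⟨z * y, mul_mem (h2 hz) hy, by rw [conj_mul_smul]; exact hz'⟩

theorem BlockSeparable.hasHall_of_isBlock (hY : BlockSeparable π Y) (hW : NormalIn W Y)
    (hσ : IsBlock π σ) : HasHall σ W Y := by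
  rcases hσ with rfl | ⟨p, -, rfl⟩
  · exact hY.hasHall hW
  · exact hasHall_singleton_of_normalIn hW p

end Subgroup

/-! ### Two sources of Dnormal subgroups, and the closure properties they give. -/

namespace Subgroup

section Dnormal

variable {X : Type*} [Group X] [Finite X] {π : Set Nat.Primes}

theorem piResidual_map_subtype (H : Subgroup X) :
    (NormalIn ((piResidual π H).map H.subtype) H ∧
      PiIndex π ((piResidual π H).map H.subtype) H) ∧
    ∀ S, NormalIn S H → PiIndex π S H → (piResidual π H).map H.subtype ≤ S := by
  obtain ⟨R, ⟨-, h1, h2⟩, h3⟩ := exists_least_piIndex π (bot_le (a := H))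
  have hn := h1.subgroupOf_normal
  have heq : (piResidual π H).map H.subtype = R := by
    have : piResidual π H = R.subgroupOf H := by
      refine le_antisymm (sInf_le ⟨hn, h2⟩) (le_sInf ?_)
      rintro N ⟨hN, hNi⟩
      have hs : (N.map H.subtype).subgroupOf H = N :=
        comap_map_eq_self_of_injective H.subtype_injective _
      have h4 : NormalIn (N.map H.subtype) H := by
        rw [NormalIn.iff_subgroupOf (map_subtype_le _), hs]; exact hN
      have h5 : PiIndex π (N.map H.subtype) H := by
        unfold PiIndex; rw [relIndex, hs]; exact hNi
      have := comap_mono (f := H.subtype) (h3 _ bot_le h4 h5)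
      exact this.trans hs.le
    rw [this, subgroupOf_map_subtype, inf_eq_left.2 h1.1]
  rw [heq]
  exact ⟨⟨h1, h2⟩, fun S => h3 S bot_le⟩

theorem normalIn_piResidual_map_subtype {H Y : Subgroup X} (h : NormalIn H Y) :
    NormalIn ((piResidual π H).map H.subtype) Y := by
  obtain ⟨⟨h1, h2⟩, h3⟩ := piResidual_map_subtype (π := π) H
  refine NormalIn.of_conj_smul_le (h1.1.trans h.1) fun y hy => ?_
  rw [conj_smul_le_iff]
  exact le_conj_smul_of_least (U := ⊥) ⟨bot_le, h1, h2⟩ (fun S _ => h3 S) (smul_bot _)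
    (h.conj_eq (inv_mem hy))

theorem isDnormal_of_normal {T : Subgroup X} (hT : T.Normal) : IsDnormal π T := by
  have h1 := NormalIn.top_iff.2 hT
  exact ⟨fun p _ P _ => le_top.trans h1.2, fun p _ P _ => ⟨fun _ => le_top.trans h1.2, fun _ =>
    le_top.trans (normalIn_piResidual_map_subtype h1).2⟩⟩

/-- For `p ∉ π` the Sylow `p`-subgroups lie in `W ≤ T`. For `p ∈ π` the point is that `O^π(T) =
O^π(W)`, which is normal because `W` is. -/
theorem isDnormal_of_isPiNumber_index (hπ : π.Nontrivial) {W T : Subgroup X} (hW : W.Normal)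
    (hWT : W ≤ T) (hi : IsPiNumber π W.index) : IsDnormal π T := by
  have hWn := NormalIn.top_iff.2 hW
  have hWi : PiIndex π W ⊤ := by unfold PiIndex; rwa [relIndex_top_right]
  refine ⟨fun p hp P _ => ?_, fun p _ P _ => ⟨?_, fun _ => ?_⟩⟩
  · have h1 : PiIndex {p} W (P : Subgroup X) :=
      have : Fact (p : ℕ).Prime := ⟨p.2⟩
      (P.isPGroup'.isPiNumber_card).of_dvd (relIndex_dvd_card _ _)
    have h2 : PiIndex π W (P : Subgroup X) := hWi.restrict hWn le_top
    exact (PiIndex.le (Set.disjoint_singleton_left.2 hp) h1 h2).trans (hWT.trans le_normalizer)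
  · rintro rfl
    exact absurd hπ Set.not_nontrivial_singleton
  · obtain ⟨⟨h1, h2⟩, h3⟩ := piResidual_map_subtype (π := π) T
    obtain ⟨R, -, r1, r2, r3, r4⟩ :=
      exists_least_piIndex_normalIn π (bot_le (a := W)) NormalIn.bot hWn
    have e1 := h3 R (r1.mono (r2.trans hWT) le_top) (r3.trans r2 hWT (hWi.left hWT le_top))
    have e2 := r4 _ bot_le (h1.mono (e1.trans r2) hWT) (h2.left (e1.trans r2) hWT)
    rw [le_antisymm e1 e2]
    exact le_top.trans r1.2

end Dnormal

/-- The closure properties of `𝔑^π`-Fitting sets, in terms of normal subgroups and subgroups of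
`π`-index. -/
structure FittingClosed {G : Type*} [Group G] (π : Set Nat.Primes) (F : Set (Subgroup G)) :
    Prop where
  bot_mem : ⊥ ∈ F
  of_normalIn : ∀ {S T : Subgroup G}, S ∈ F → NormalIn T S → T ∈ F
  sup_mem : ∀ {S T : Subgroup G}, S ∈ F → T ∈ F → NormalIn S (S ⊔ T) → NormalIn T (S ⊔ T) →
    S ⊔ T ∈ F
  conj_mem : ∀ {S : Subgroup G} (g : G), S ∈ F → MulAut.conj g • S ∈ F
  of_piIndex : π.Nontrivial → ∀ {S T W : Subgroup G}, S ∈ F → NormalIn W S → PiIndex π W S →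
    W ≤ T → T ≤ S → T ∈ F
  sup_mem_of_piIndex : π.Nontrivial → ∀ {S T W : Subgroup G}, S ∈ F → T ∈ F →
    NormalIn W (S ⊔ T) → PiIndex π W (S ⊔ T) → W ≤ S → W ≤ T → S ⊔ T ∈ F

variable {G : Type*} [Group G] [Finite G] {π : Set Nat.Primes}

theorem NormalIn.isDnormalIn {S T : Subgroup G} (h : NormalIn S T) : IsDnormalIn π S T :=
  ⟨h.1, isDnormal_of_normal h.subgroupOf_normal⟩

theorem isDnormalIn_of_piIndex (hπ : π.Nontrivial) {S T W : Subgroup G} (h : NormalIn W S)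
    (hi : PiIndex π W S) (hWT : W ≤ T) (hTS : T ≤ S) : IsDnormalIn π T S :=
  ⟨hTS, isDnormal_of_isPiNumber_index hπ h.subgroupOf_normal (comap_mono hWT) hi⟩

theorem _root_.IsNPiFittingSet.fittingClosed {F : Set (Subgroup G)} (hF : IsNPiFittingSet π F) :
    FittingClosed π F where
  bot_mem := by
    obtain ⟨S, hS⟩ := hF.nonempty
    exact hF.fs1 S hS ⊥ (.single NormalIn.bot.isDnormalIn)
  of_normalIn hS h := hF.fs1 _ hS _ (.single h.isDnormalIn)
  sup_mem hS hT h h' := hF.fs2 _ hS _ hT h.isDnormalIn h'.isDnormalIn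
  conj_mem g hS := by simpa using hF.fs3 _ hS g⁻¹
  of_piIndex hπ _ _ _ hS h hi h1 h2 := hF.fs1 _ hS _ (.single (isDnormalIn_of_piIndex hπ h hi h1 h2))
  sup_mem_of_piIndex hπ _ _ _ hS hT h hi h1 h2 := hF.fs2 _ hS _ hT
    (isDnormalIn_of_piIndex hπ h hi h1 le_sup_left) (isDnormalIn_of_piIndex hπ h hi h2 le_sup_right)

end Subgroup

/-! ### `F`-maximal subgroups above an `F`-maximal subgroup of a normal subgroup. -/

namespace Subgroup

variable {G : Type*} [Group G] {π σ : Set Nat.Primes} {F : Set (Subgroup G)}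
  {M H V W : Subgroup G}

theorem PiIndex.le_of_empty {A B : Subgroup G} (h : PiIndex ∅ A B) : B ≤ A := by
  rw [← relIndex_eq_one]
  by_contra hne
  obtain ⟨p, hp, hd⟩ := Nat.exists_prime_and_dvd hne
  exact h ⟨p, hp⟩ hd

/-- `V` is maximal among the members of `F` contained in `H`. -/
def FMax (F : Set (Subgroup G)) (H V : Subgroup G) : Prop :=
  Maximal (fun S : Subgroup G => S ≤ H ∧ S ∈ F) V

namespace FMax

theorem le (h : FMax F H V) : V ≤ H := h.prop.1

theorem mem (h : FMax F H V) : V ∈ F := h.prop.2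

theorem eq (h : FMax F H V) {S : Subgroup G} (hS : S ∈ F) (hSH : S ≤ H) (hVS : V ≤ S) : S = V :=
  le_antisymm (h.le_of_ge ⟨hSH, hS⟩ hVS) hVS

theorem mono (h : FMax F H V) (hM : M ≤ H) (hV : V ≤ M) : FMax F M V :=
  ⟨⟨hV, h.mem⟩, fun _ hS hVS => h.le_of_ge ⟨hS.1.trans hM, hS.2⟩ hVS⟩

theorem inf_eq (hF : FittingClosed π F) (hW : FMax F M W) (hM : NormalIn M H) (hV : V ∈ F)
    (hVH : V ≤ H) (hWV : W ≤ V) : V ⊓ M = W :=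
  hW.eq (hF.of_normalIn hV (hM.inf_left hVH)) inf_le_right (le_inf hWV hW.le)

theorem normalIn (hF : FittingClosed π F) (hW : FMax F M W) (hM : NormalIn M H) (hV : V ∈ F)
    (hVH : V ≤ H) (hWV : W ≤ V) : NormalIn W V :=
  inf_eq hF hW hM hV hVH hWV ▸ hM.inf_left hVH

theorem piIndex (hF : FittingClosed π F) (hW : FMax F M W) (hM : NormalIn M H) (hV : V ∈ F)
    (hVH : V ≤ H) (hWV : W ≤ V) (hi : PiIndex σ M H) : PiIndex σ W V := by
  rw [← inf_eq hF hW hM hV hVH hWV, PiIndex.inf_left]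
  exact hi.restrict hM hVH

end FMax

variable [Finite G]

/-- Maximal subgroups of a nilpotent group are normal. -/
theorem exists_normal_lt_top_of_isNilpotent [W.Normal] [Group.IsNilpotent (G ⧸ W)]
    {S : Subgroup G} (hWS : W ≤ S) (hS : S ≠ ⊤) : ∃ M : Subgroup G, M.Normal ∧ S ≤ M ∧ M ≠ ⊤ := by
  set f := QuotientGroup.mk' W
  have hf : Function.Surjective f := QuotientGroup.mk'_surjective _
  have hker : f.ker = W := QuotientGroup.ker_mk' _
  have hne : S.map f ≠ ⊤ := by
    intro h
    have h1 := congrArg (comap f) h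
    have hk : f.ker ≤ S := hker.trans_le hWS
    rw [comap_map_eq_self hk, comap_top] at h1
    exact hS h1
  obtain ⟨N, hN, hSN⟩ := (eq_top_or_exists_le_coatom _).resolve_left hne
  have hNn : N.Normal := NormalizerCondition.normal_of_coatom N
    Group.normalizerCondition_of_isNilpotent hN
  refine ⟨N.comap f, hNn.comap f, map_le_iff_le_comap.1 hSN, fun h => hN.1 ?_⟩
  rw [← map_comap_eq_self_of_surjective hf N, h, map_top_of_surjective f hf]

theorem exists_normalIn_lt_of_piIndex {p : Nat.Primes} (hW : NormalIn W H)
    (hi : PiIndex {p} W H) {S : Subgroup G} (hWS : W ≤ S) (hS : S < H) :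
    ∃ M, NormalIn M H ∧ S ≤ M ∧ M < H := by
  have := hW.subgroupOf_normal
  have : Fact (p : ℕ).Prime := ⟨p.2⟩
  have hQ : IsPGroup (p : ℕ) (H ⧸ W.subgroupOf H) := IsPiNumber.isPGroup hi
  have := hQ.isNilpotent
  obtain ⟨M, hM, hSM, hne⟩ := exists_normal_lt_top_of_isNilpotent (W := W.subgroupOf H)
    (S := S.subgroupOf H) (comap_mono hWS) (fun h => hS.not_ge (subgroupOf_eq_top.1 h))
  have hMs : (M.map H.subtype).subgroupOf H = M :=
    comap_map_eq_self_of_injective H.subtype_injective _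
  refine ⟨M.map H.subtype, ?_, fun x hx => ⟨⟨x, hS.le hx⟩, hSM hx, rfl⟩,
    (map_subtype_le _).lt_of_ne fun h => hne ?_⟩
  · rw [NormalIn.iff_subgroupOf (map_subtype_le _), hMs]; exact hM
  · rw [← hMs, h, subgroupOf_self]

namespace FittingClosed

/-- A member `S ≠ H` lies in a proper normal subgroup `M` of `H`. By induction `M` has a greatest
member `D` above `W`; uniqueness makes `D` normal in `H`, so normal joins absorb it into a maximal
normal member `E`. -/
theorem exists_greatest_singleton (hF : FittingClosed π F) {p : Nat.Primes} (hW : W ∈ F)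
    (hn : NormalIn W H) (hi : PiIndex {p} W H) :
    ∃ E ∈ F, W ≤ E ∧ E ≤ H ∧ ∀ S ∈ F, W ≤ S → S ≤ H → S ≤ E := by
  induction hc : Nat.card H using Nat.strong_induction_on generalizing H with
  | _ n ih =>
    subst hc
    by_cases hHF : H ∈ F
    · exact ⟨H, hHF, hn.1, le_rfl, fun S _ _ h => h⟩
    obtain ⟨E, hE⟩ := (Set.toFinite {E | E ∈ F ∧ W ≤ E ∧ NormalIn E H}).exists_maximal
      ⟨W, hW, le_rfl, hn⟩
    refine ⟨E, hE.prop.1, hE.prop.2.1, hE.prop.2.2.1, fun S hS hWS hSH => ?_⟩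
    have hlt : S < H := hSH.lt_of_ne (fun h => hHF (h ▸ hS))
    obtain ⟨M, hM, hSM, hMH⟩ := exists_normalIn_lt_of_piIndex hn hi hWS hlt
    obtain ⟨D, hD, hWD, hDM, hDmax⟩ := ih _ (natCard_lt_of_lt hMH)
      (hn.mono (hWS.trans hSM) hM.1) (hi.left (hWS.trans hSM) hM.1) rfl
    have hDn : NormalIn D H := NormalIn.of_conj_smul_le (hDM.trans hM.1) fun x hx =>
      hDmax _ (hF.conj_mem x hD) (by rw [← hn.conj_eq hx]; exact conj_smul_mono hWD)
        (by rw [← hM.conj_eq hx]; exact conj_smul_mono hDM)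
    have hsup := hE.prop.2.2.sup hDn
    have : E ⊔ D ∈ F := hF.sup_mem hE.prop.1 hD (hE.prop.2.2.mono le_sup_left hsup.1)
      (hDn.mono le_sup_right hsup.1)
    have := hE.le_of_ge (y := E ⊔ D) ⟨this, hWD.trans le_sup_right, hsup⟩ le_sup_left
    exact (hDmax S hS hWS hSM).trans (le_sup_right.trans this)

/-- For `σ = π` with at least two primes, joins of members above `W` stay in `F` without any
normality. All other nonempty blocks are single primes. -/
theorem exists_greatest (hF : FittingClosed π F) (hσ : IsBlock π σ) (hW : W ∈ F)
    (hn : NormalIn W H) (hi : PiIndex σ W H) :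
    ∃ E ∈ F, W ≤ E ∧ E ≤ H ∧ ∀ S ∈ F, W ≤ S → S ≤ H → S ≤ E := by
  rcases hσ with rfl | ⟨p, -, rfl⟩
  · rcases σ.eq_empty_or_nonempty with rfl | hne
    · exact ⟨W, hW, le_rfl, hn.1, fun S _ _ hS => hS.trans hi.le_of_empty⟩
    rcases hne.exists_eq_singleton_or_nontrivial with ⟨p, rfl⟩ | hnt
    · exact hF.exists_greatest_singleton hW hn hi
    · obtain ⟨E, hE⟩ := (Set.toFinite {E | E ∈ F ∧ W ≤ E ∧ E ≤ H}).exists_maximal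
        ⟨W, hW, le_rfl, hn.1⟩
      obtain ⟨e1, e2, e3⟩ := hE.prop
      refine ⟨E, e1, e2, e3, fun S hS hWS hSH => ?_⟩
      have hle : S ⊔ E ≤ H := sup_le hSH e3
      have hWle : W ≤ S ⊔ E := hWS.trans le_sup_left
      have := hF.sup_mem_of_piIndex hnt hS e1 (hn.mono hWle hle) (hi.left hWle hle) hWS e2
      exact le_sup_left.trans (hE.le_of_ge (y := S ⊔ E) ⟨this, hWle, hle⟩ le_sup_right)
  · exact hF.exists_greatest_singleton hW hn hi

end FittingClosed

namespace FMax

theorem of_card (hV : V ∈ F) (hVH : V ≤ H)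
    (h : ∀ S ∈ F, S ≤ H → V ≤ S → Nat.card S ≤ Nat.card V) : FMax F H V :=
  ⟨⟨hVH, hV⟩, fun S hS hVS => (eq_of_le_of_natCard_le hVS (h S hS.2 hS.1 hVS)).ge⟩

theorem exists_le (hV : V ∈ F) (hVH : V ≤ H) : ∃ E, FMax F H E ∧ V ≤ E := by
  obtain ⟨E, hE, hmax⟩ := (Set.toFinite {S | S ≤ H ∧ S ∈ F}).exists_le_maximal ⟨hVH, hV⟩
  exact ⟨E, hmax, hE⟩

theorem conj (hF : FittingClosed π F) (h : FMax F H V) (g : G) :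
    FMax F (MulAut.conj g • H) (MulAut.conj g • V) := by
  refine of_card (hF.conj_mem g h.mem) (conj_smul_mono h.le) fun S hS hSH hVS => ?_
  rw [← h.eq (hF.conj_mem g⁻¹ hS), card_conj_smul, card_conj_smul]
  · rwa [conj_smul_le_iff, inv_inv]
  · rwa [← conj_smul_le_iff]

/-- An `F`-maximal subgroup `V` of `H` containing an `F`-maximal subgroup `W` of `M` is the largest
member of `F` above `W` in a suitable Hall `σ`-subgroup `E` of the normalizer of `W` modulo `W`. -/
theorem exists_hall (hF : FittingClosed π F) (hH : BlockSeparable π H) (hσ : IsBlock π σ)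
    (hM : NormalIn M H) (hi : PiIndex σ M H) (hW : FMax F M W) (hV : FMax F H V) (hWV : W ≤ V) :
    ∃ E, NormalIn V E ∧ E ≤ H ⊓ normalizer (W : Set G) ∧
      PiIndex σᶜ E (H ⊓ normalizer (W : Set G)) ∧ (∀ S ∈ F, W ≤ S → S ≤ E → S ≤ V) ∧
      ∀ S, W ≤ S → S ≤ H ⊓ normalizer (W : Set G) → PiIndex σ W S →
        ∃ y ∈ H ⊓ normalizer (W : Set G), MulAut.conj y • S ≤ E := by
  set Y := H ⊓ normalizer (W : Set G)
  have hWY : NormalIn W Y := ⟨le_inf (hW.le.trans hM.1) le_normalizer, inf_le_right⟩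
  obtain ⟨E, e1, e2, e3, e4, e5⟩ := (hH.mono inf_le_left : BlockSeparable π Y).hasHall_of_isBlock
    hWY hσ
  have hVY : V ≤ Y := le_inf hV.le (hW.normalIn hF hM hV.mem hV.le hWV).2
  obtain ⟨y, hy, hyE⟩ := e5 V hWV hVY (hW.piIndex hF hM hV.mem hV.le hWV hi)
  have hy' := inv_mem hy
  have hVE : V ≤ MulAut.conj y⁻¹ • E := conj_smul_le_iff.1 hyE
  have hWE : W ≤ MulAut.conj y⁻¹ • E := by rw [← hWY.conj_eq hy']; exact conj_smul_mono e1
  have hEY : MulAut.conj y⁻¹ • E ≤ Y := conj_smul_le_of_mem e2 hy'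
  have hWEi : PiIndex σ W (MulAut.conj y⁻¹ • E) := by
    have := e3.conj y⁻¹; rwa [hWY.conj_eq hy'] at this
  have hEYi : PiIndex σᶜ (MulAut.conj y⁻¹ • E) Y := by
    have := e4.conj y⁻¹; rwa [conj_smul_eq_self_of_mem hy'] at this
  -- The greatest member `D` of the Hall subgroup contains `V`, so `D = V` by maximality of `V` in
  -- `H`; being greatest, it is normalized by the Hall subgroup.
  obtain ⟨D, hD, hWD, hDE, hDmax⟩ := hF.exists_greatest hσ hW.mem (hWY.mono hWE hEY) hWEi
  obtain rfl := hV.eq hD (hDE.trans (hEY.trans inf_le_left)) (hDmax V hV.mem hWV hVE)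
  refine ⟨_, ?_, hEY, hEYi, hDmax, fun S s1 s2 s3 => ?_⟩
  · refine NormalIn.of_conj_smul_le hDE fun x hx => hDmax _ (hF.conj_mem x hD) ?_ ?_
    · rw [← hWY.conj_eq (hEY hx)]; exact conj_smul_mono hWD
    · exact conj_smul_le_of_mem hDE hx
  · obtain ⟨z, hz, hz'⟩ := e5 S s1 s2 s3
    exact ⟨y⁻¹ * z, mul_mem hy' hz, by rw [conj_mul_smul]; exact conj_smul_mono hz'⟩

/-- Hall's theorem moves `S` into the Hall subgroup attached to `V`, where `V` is the greatest
member of `F` above `W`. The conjugating element also fixes `W`. -/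
theorem exists_conj_smul_le (hF : FittingClosed π F) (hH : BlockSeparable π H)
    (hσ : IsBlock π σ) (hM : NormalIn M H) (hi : PiIndex σ M H) (hW : FMax F M W)
    (hV : FMax F H V) (hWV : W ≤ V) {S : Subgroup G} (hS : S ∈ F) (hWS : W ≤ S) (hSH : S ≤ H) :
    ∃ y ∈ H, MulAut.conj y • W = W ∧ MulAut.conj y • S ≤ V := by
  obtain ⟨E, -, h2, -, h4, h5⟩ := exists_hall hF hH hσ hM hi hW hV hWV
  obtain ⟨y, hy, hyE⟩ := h5 S hWS (le_inf hSH (hW.normalIn hF hM hS hSH hWS).2)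
    (hW.piIndex hF hM hS hSH hWS hi)
  have hyW : MulAut.conj y • W = W := mem_normalizer_iff_conj_smul_eq.1 hy.2
  refine ⟨y, hy.1, hyW, h4 _ (hF.conj_mem y hS) ?_ hyE⟩
  conv_lhs => rw [← hyW]
  exact conj_smul_mono hWS

end FMax

end Subgroup

/-! ### Injectors, and joining `F`-maximal subgroups of two normal subgroups. -/

namespace Subgroup

variable {G : Type*} [Group G] {π σ τ : Set Nat.Primes} {F : Set (Subgroup G)}
  {M M' H K L V W : Subgroup G}

theorem NormalIn.commutator_mem (hM : NormalIn M H) (hM' : NormalIn M' H) {a x : G} (ha : a ∈ M)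
    (hx : x ∈ M') : a * x * a⁻¹ * x⁻¹ ∈ M ⊓ M' := by
  constructor
  · have := hM.conj_mem (hM'.1 hx) (M.inv_mem ha)
    have := mul_mem ha this
    simpa [mul_assoc] using this
  · exact M'.mul_mem (hM'.conj_mem (hM.1 ha) hx) (M'.inv_mem hx)

/-- If `axr ∈ M ∩ M'`, then `x ∈ X ∩ M ≤ R` and `a ∈ A ∩ M' ≤ R`. So the product meets `M ∩ M'` only
in `R`, which is too small for it to be `H`. -/
theorem sup_sup_lt {A X R : Subgroup G} (hM : NormalIn M H) (hM' : NormalIn M' H) (hA : A ≤ M) (hX : X ≤ M')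
    (hAR : A ⊓ M' ≤ R) (hXR : X ⊓ M ≤ R) (hRH : NormalIn R H) (hRL : R < M ⊓ M')
    (hN : A ≤ normalizer ((X ⊔ R : Subgroup G) : Set G)) : A ⊔ (X ⊔ R) < H := by
  refine lt_of_le_of_ne (sup_le (hA.trans hM.1) (sup_le (hX.trans hM'.1) hRH.1)) fun heq => ?_
  refine hRL.not_ge fun t ht => ?_
  have htH : t ∈ A ⊔ (X ⊔ R) := heq ▸ hM.1 ht.1
  obtain ⟨a, ha, b, hb, rfl⟩ := exists_mul_of_mem_sup hN htH
  obtain ⟨x, hx, r, hr, rfl⟩ := exists_mul_of_mem_sup ((hX.trans hM'.1).trans hRH.2) hb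
  have hxM : x ∈ M := by
    have := M.mul_mem (M.mul_mem (M.inv_mem (hA ha)) ht.1) (M.inv_mem (hRL.le hr).1)
    simpa [mul_assoc] using this
  have hxR := hXR ⟨hx, hxM⟩
  have haM : a ∈ M' := by
    have := M'.mul_mem ht.2 (M'.inv_mem (hRL.le (mul_mem hxR hr)).2)
    simpa [mul_assoc] using this
  exact mul_mem (hAR ⟨ha, haM⟩) (mul_mem hxR hr)

/-- `K` is a subnormal subgroup of the subgroup `H` of the ambient group. -/
def SubnormalIn (K H : Subgroup G) : Prop := Relation.ReflTransGen NormalIn K H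

theorem NormalIn.subnormalIn (h : NormalIn M H) : SubnormalIn M H := .single h

namespace SubnormalIn

theorem le (h : SubnormalIn K H) : K ≤ H := by
  induction h with
  | refl => exact le_rfl
  | tail _ h ih => exact ih.trans h.1

theorem conj (h : SubnormalIn K H) (g : G) :
    SubnormalIn (MulAut.conj g • K) (MulAut.conj g • H) := by
  induction h with
  | refl => exact .refl
  | tail _ h ih => exact ih.tail (h.conj g)

theorem eq_or_exists_normalIn (h : SubnormalIn K H) :
    K = H ∨ ∃ M, NormalIn M H ∧ M < H ∧ SubnormalIn K M := by
  induction h with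
  | refl => exact .inl rfl
  | @tail B C hB h ih =>
    by_cases hBC : B = C
    · subst hBC; exact ih
    · exact .inr ⟨B, h, h.1.lt_of_ne hBC, hB⟩

end SubnormalIn

/-- `V` is an `F`-injector of the subgroup `H` of the ambient group. -/
def IsInjectorOf (F : Set (Subgroup G)) (H V : Subgroup G) : Prop :=
  V ≤ H ∧ ∀ K, SubnormalIn K H → FMax F K (V ⊓ K)

namespace IsInjectorOf

theorem le (h : IsInjectorOf F H V) : V ≤ H := h.1

theorem fmax (h : IsInjectorOf F H V) : FMax F H V := by
  have := h.2 H .refl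
  rwa [inf_eq_left.2 h.1] at this

theorem mem (h : IsInjectorOf F H V) : V ∈ F := h.fmax.mem

theorem inf (h : IsInjectorOf F H V) (hM : NormalIn M H) : IsInjectorOf F M (V ⊓ M) := by
  refine ⟨inf_le_right, fun K hK => ?_⟩
  rw [inf_assoc, inf_eq_right.2 hK.le]
  exact h.2 K (hK.tail hM)

theorem of_normalIn (hV : FMax F H V)
    (h : ∀ M, NormalIn M H → M < H → IsInjectorOf F M (V ⊓ M)) : IsInjectorOf F H V := by
  refine ⟨hV.le, fun K hK => ?_⟩
  rcases hK.eq_or_exists_normalIn with rfl | ⟨M, hM, hlt, hKM⟩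
  · rwa [inf_eq_left.2 hV.le]
  · have := (h M hM hlt).2 K hKM
    rwa [inf_assoc, inf_eq_right.2 hKM.le] at this

theorem le_of_subnormalIn (h : IsInjectorOf F H V) (hK : SubnormalIn K H) (hKF : K ∈ F) :
    K ≤ V := by
  rw [← inf_eq_right]
  exact ((h.2 K hK).eq hKF le_rfl inf_le_right).symm

theorem conj [Finite G] (hF : FittingClosed π F) (h : IsInjectorOf F H V) (g : G) :
    IsInjectorOf F (MulAut.conj g • H) (MulAut.conj g • V) := by
  refine ⟨conj_smul_mono h.1, fun K hK => ?_⟩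
  have h1 := hK.conj g⁻¹
  rw [conj_inv_smul_smul] at h1
  have := (h.2 _ h1).conj hF g
  rwa [conj_smul_inf, conj_smul_inv_smul] at this

/-- The Frattini argument for injectors. -/
theorem exists_mul_mem_normalizer [Finite G] (hF : FittingClosed π F) (hM : NormalIn M H)
    (hW : IsInjectorOf F M W)
    (hconj : ∀ W', IsInjectorOf F M W' → ∃ m ∈ M, MulAut.conj m • W' = W) {x : G} (hx : x ∈ H) :
    ∃ m ∈ M, m * x ∈ normalizer (W : Set G) := by
  have := hW.conj hF x
  rw [hM.conj_eq hx] at this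
  obtain ⟨m, hm, he⟩ := hconj _ this
  exact ⟨m, hm, by rwa [mem_normalizer_iff_conj_smul_eq, conj_mul_smul]⟩

end IsInjectorOf

/-- Existence, conjugacy and a recursive description of the `F`-injectors of `H`. -/
structure InjectorTheory (π : Set Nat.Primes) (F : Set (Subgroup G)) (H : Subgroup G) :
    Prop where
  exists_injector : ∃ V, IsInjectorOf F H V
  exists_conj : ∀ V W, IsInjectorOf F H V → IsInjectorOf F H W → ∃ x ∈ H, MulAut.conj x • W = V
  of_fmax : ∀ {M σ W V}, NormalIn M H → IsBlock π σ → PiIndex σ M H → IsInjectorOf F M W →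
    FMax F H V → W ≤ V → IsInjectorOf F H V

variable [Finite G]

theorem relIndex_sup_left_of_le_normalizer {T L : Subgroup G}
    (h : T ≤ normalizer (L : Set G)) : T.relIndex (T ⊔ L) = T.relIndex L := by
  have h1 := card_eq_card_mul_relIndex (le_sup_right : L ≤ T ⊔ L)
  have h2 := card_eq_card_mul_relIndex (le_sup_left : T ≤ T ⊔ L)
  have h3 := card_eq_card_mul_relIndex (inf_le_left : T ⊓ L ≤ T)
  have h4 := card_eq_card_mul_relIndex (inf_le_right : T ⊓ L ≤ L)
  rw [relIndex_sup_of_le_normalizer h] at h1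
  rw [inf_relIndex_left] at h3
  rw [inf_relIndex_right] at h4
  have h5 : 0 < Nat.card T := Nat.card_pos
  apply Nat.eq_of_mul_eq_mul_left h5
  rw [h2, ← h1, ← h3, ← h4]
  ring

section CoprimeSections

variable {ν : Set Nat.Primes} {A X U R : Subgroup G}

/-- Put `L = M ∩ M'` and `Y = AL`. A Frattini argument gives `Y = N_Y(X) L`, so `N_Y(X) R` has
`τ'`-index in `Y` because `|L : R|` is a `τ'`-number. Since `AR / R` is a `τ`-group, a conjugate of
`A` lies in `N_Y(X) R`, which normalizes `XR`. -/
theorem exists_conj_smul_le_normalizer_sup (hF : FittingClosed π F) (hH : BlockSeparable π H)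
    (hσ : IsBlock π σ) (hτ : IsBlock π τ) (hM : NormalIn M H) (hM' : NormalIn M' H)
    (hA : A ≤ M) (hX : FMax F M' X) (hAU : A ⊓ M' = U) (hUX : U ≤ X)
    (hU : FMax F (M ⊓ M') U) (hMi : PiIndex τ (M ⊓ M') M) (hMi' : PiIndex σ (M ⊓ M') M')
    (hUH : NormalIn U H) (hUR : U ≤ R) (hRH : NormalIn R H) (hRL : R ≤ M ⊓ M')
    (hR : PiIndex τᶜ R (M ⊓ M')) :
    ∃ g ∈ H, MulAut.conj g • A ≤ normalizer ((X ⊔ R : Subgroup G) : Set G) := by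
  set L := M ⊓ M' with hLdef
  have hLH : NormalIn L H := hM.inf hM'
  have hXH : X ≤ H := hX.le.trans hM'.1
  have hAH : A ≤ H := hA.trans hM.1
  have hXL : X ⊔ L ≤ M' := sup_le hX.le inf_le_right
  have hLX : NormalIn L (X ⊔ L) := hLH.mono le_sup_right (hXL.trans hM'.1)
  have hLXi : PiIndex σ L (X ⊔ L) := hMi'.left le_sup_right hXL
  have hcov : ∀ a ∈ A, ∃ l ∈ L, l * a ∈ normalizer (X : Set G) := by
    intro a ha
    -- Commutators of `A ≤ M` with `X ≤ M'` lie in `L`. Thus `X` and its conjugate are `F`-subgroups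
    -- of `XL` above `U`, where conjugacy is available.
    have hS : MulAut.conj a • X ≤ X ⊔ L := by
      intro x hx
      rw [mem_conj_smul_iff] at hx
      have h1 := hM.commutator_mem hM' (hA ha) (hX.le hx)
      have h2 := mul_mem (mem_sup_right (S := X) h1) (mem_sup_left (T := L) hx)
      simpa [mul_assoc] using h2
    obtain ⟨y, hy, -, hyX⟩ := FMax.exists_conj_smul_le hF (hH.mono (hXL.trans hM'.1)) hσ hLX hLXi hU
      (hX.mono hXL le_sup_left) hUX (hF.conj_mem a hX.mem)
      (by rw [← hUH.conj_eq (hAH ha)]; exact conj_smul_mono hUX) hS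
    have heq : MulAut.conj (y * a) • X = X := by
      rw [conj_mul_smul]
      refine eq_of_le_of_natCard_le hyX ?_
      rw [card_conj_smul, card_conj_smul]
    obtain ⟨x, hx, l, hl, rfl⟩ := exists_mul_of_mem_sup (hXH.trans hLH.2) hy
    refine ⟨l, hl, ?_⟩
    have h1 := mul_mem (inv_mem (le_normalizer (H := X) hx)) (mem_normalizer_iff_conj_smul_eq.2 heq)
    simpa [mul_assoc] using h1
  set Y := A ⊔ L with hY
  have hYH : Y ≤ H := sup_le hAH hLH.1
  set C := normalizer (X : Set G) ⊓ Y with hC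
  have hCY : C ⊔ R ≤ Y := sup_le inf_le_right (hRL.trans le_sup_right)
  have hYeq : (C ⊔ R) ⊔ L = Y := by
    refine le_antisymm (sup_le hCY le_sup_right) (sup_le (fun a ha => ?_) le_sup_right)
    obtain ⟨l, hl, hla⟩ := hcov a ha
    have h1 : l * a ∈ C := ⟨hla, mul_mem (mem_sup_right hl) (mem_sup_left ha)⟩
    have h2 := mul_mem (mem_sup_right (S := C ⊔ R) (inv_mem hl))
      (mem_sup_left (T := L) (mem_sup_left (T := R) h1))
    simpa using h2
  have hi : PiIndex τᶜ (C ⊔ R) Y := by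
    unfold PiIndex
    rw [← hYeq, relIndex_sup_left_of_le_normalizer (hCY.trans (hYH.trans hLH.2))]
    exact hR.right le_sup_right
  have hRY : NormalIn R Y := hRH.mono (hRL.trans le_sup_right) hYH
  have hAi : PiIndex τ R (A ⊔ R) := by
    rw [PiIndex.sup_iff (hAH.trans hRH.2)]
    have h1 : PiIndex τ L A := hMi.restrict (hLH.mono inf_le_left hM.1) hA
    rw [← PiIndex.inf_left, hLdef, ← inf_assoc, inf_eq_left.2 hA, hAU] at h1
    exact h1.right hUR
  obtain ⟨y, hy, hyA⟩ := HasHall.exists_conj_smul_le ((hH.mono hYH).hasHall_of_isBlock hRY hτ)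
    ((hH.mono (hCY.trans hYH)).hasHall_of_isBlock (hRY.mono le_sup_right hCY) hτ) hCY hi hRY
    le_sup_right (sup_le le_sup_left (hRL.trans le_sup_right)) hAi
  refine ⟨y, hYH hy, (conj_smul_mono le_sup_left).trans (hyA.trans (sup_le ?_ ?_))⟩
  · exact (le_inf inf_le_left (inf_le_right.trans (hYH.trans hRH.2))).trans
      (normalizer_inf_normalizer_le_normalizer_sup X R)
  · exact le_sup_right.trans le_normalizer

/-- An injector `V` of `T` contains the normal member `U` and is `F`-maximal on `T ∩ M`. Conjugacy
above `U` in `T ∩ M` then moves the given conjugate of `A` into `V`. -/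
theorem exists_conj_smul_le_of_lt (hF : FittingClosed π F) (hH : BlockSeparable π H)
    (hσ : IsBlock π σ) (hM : NormalIn M H) (hL : NormalIn L H) (hLM : L ≤ M) (hA : FMax F M A)
    (hU : FMax F L U) (hMi : PiIndex σ L M) {T : Subgroup G} (hTH : T ≤ H) (hUT : NormalIn U T)
    (hV : IsInjectorOf F T V) {g : G} (hg : g ∈ H) (hAT : MulAut.conj g • A ≤ T)
    (hUA : U ≤ MulAut.conj g • A) :
    ∃ x ∈ H, MulAut.conj x • A ≤ V := by
  have hTM : NormalIn (T ⊓ M) T := hM.inf_left hTH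
  have hLT : NormalIn (T ⊓ L) (T ⊓ M) :=
    (hL.inf_left hTH).mono (inf_le_inf_left _ hLM) inf_le_left
  have hAM := hA.conj hF g
  rw [hM.conj_eq hg] at hAM
  have hi : PiIndex σ (T ⊓ L) (T ⊓ M) := by
    have := hMi.restrict (hL.mono hLM hM.1) (inf_le_right : T ⊓ M ≤ M)
    rw [← PiIndex.inf_left] at this
    rwa [inf_assoc, inf_eq_right.2 hLM] at this
  have hUV : U ≤ V := hV.le_of_subnormalIn hUT.subnormalIn hU.mem
  obtain ⟨y, hy, -, hyV⟩ := FMax.exists_conj_smul_le hF (hH.mono (inf_le_left.trans hTH)) hσ hLT hi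
    (hU.mono inf_le_right (le_inf hUT.1 hU.le)) (hV.inf hTM).fmax
    (le_inf hUV (le_inf hUT.1 (hU.le.trans hLM))) hAM.mem hUA (le_inf hAT hAM.le)
  exact ⟨y * g, mul_mem (hTH hy.1) hg, by rw [conj_mul_smul]; exact hyV.trans inf_le_left⟩

/-- The aim is a proper subgroup `T` of `H` that normalizes `U` and contains conjugates of `A` and
`X`: an injector of `T` then does it. If `U` is not normal in `H`, take `T = N_H(U)`. If `U = M ∩
M'`, then `A` and `X` commute modulo `U` and `AX ∈ F` directly. Otherwise `T` is a product of `A`,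
`X` and a subgroup `R < M ∩ M'`, after conjugating one factor. -/
theorem exists_mem_conj_smul_le (hF : FittingClosed π F) (hH : BlockSeparable π H)
    (ih : ∀ T < H, ∃ V, IsInjectorOf F T V)
    (hσ : IsBlock π σ) (hτ : IsBlock π τ) (hne : σ ≠ τ) (hM : NormalIn M H) (hM' : NormalIn M' H)
    (hA : FMax F M A) (hX : FMax F M' X) (hAU : A ⊓ M' = U) (hXU : X ⊓ M = U)
    (hU : FMax F (M ⊓ M') U) (hMi : PiIndex τ (M ⊓ M') M) (hMi' : PiIndex σ (M ⊓ M') M') :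
    ∃ V ∈ F, V ≤ H ∧ (∃ g ∈ H, MulAut.conj g • A ≤ V) ∧ ∃ g ∈ H, MulAut.conj g • X ≤ V := by
  have hL : NormalIn (M ⊓ M') H := hM.inf hM'
  have hUA : U ≤ A := hAU ▸ inf_le_left
  have hUX : U ≤ X := hXU ▸ inf_le_left
  have hAH : A ≤ H := hA.le.trans hM.1
  have hXH : X ≤ H := hX.le.trans hM'.1
  have key : ∀ T < H, NormalIn U T → ∀ g ∈ H, ∀ x ∈ H, MulAut.conj g • A ≤ T →
      MulAut.conj x • X ≤ T → U ≤ MulAut.conj g • A → U ≤ MulAut.conj x • X →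
      ∃ V ∈ F, V ≤ H ∧ (∃ g ∈ H, MulAut.conj g • A ≤ V) ∧ ∃ g ∈ H, MulAut.conj g • X ≤ V := by
    intro T hT hUT g hg x hx h1 h2 h3 h4
    obtain ⟨V, hV⟩ := ih T hT
    exact ⟨V, hV.mem, hV.le.trans hT.le,
      exists_conj_smul_le_of_lt hF hH hτ hM hL inf_le_left hA hU hMi hT.le hUT hV hg h1 h3,
      exists_conj_smul_le_of_lt hF hH hσ hM' hL inf_le_right hX hU hMi' hT.le hUT hV hx h2 h4⟩
  by_cases hUH : H ≤ normalizer (U : Set G)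
  swap
  · have hAY : A ≤ H ⊓ normalizer (U : Set G) :=
      le_inf hAH (hAU ▸ (hM'.inf_left hAH).2)
    have hXY : X ≤ H ⊓ normalizer (U : Set G) :=
      le_inf hXH (hXU ▸ (hM.inf_left hXH).2)
    refine key _ (inf_le_left.lt_of_ne fun h => hUH (inf_eq_left.1 h))
      ⟨hUA.trans hAY, inf_le_right⟩ 1 (one_mem _) 1 (one_mem _) ?_ ?_ ?_ ?_
    · simpa using hAY
    · simpa using hXY
    · simpa
    · simpa
  replace hUH : NormalIn U H := ⟨hUA.trans hAH, hUH⟩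
  by_cases hLU : M ⊓ M' = U
  · refine ⟨A ⊔ X, hF.sup_mem hA.mem hX.mem ?_ ?_, sup_le hAH hXH, ⟨1, one_mem _, by simp⟩,
      ⟨1, one_mem _, by simp⟩⟩
    · refine ⟨le_sup_left, sup_le le_normalizer (le_normalizer_iff.2 fun x hx a ha => ?_)⟩
      have h1 := inv_mem (hM.commutator_mem hM' (hA.le ha) (hX.le hx))
      rw [hLU] at h1
      have := mul_mem (hUA h1) ha
      simpa [mul_assoc] using this
    · refine ⟨le_sup_right, sup_le (le_normalizer_iff.2 fun a ha x hx => ?_) le_normalizer⟩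
      have h1 := hM.commutator_mem hM' (hA.le ha) (hX.le hx)
      rw [hLU] at h1
      have := mul_mem (hUX h1) hx
      simpa [mul_assoc] using this
  have hlt : U < M ⊓ M' := hU.le.lt_of_ne (Ne.symm hLU)
  obtain ⟨R, ν, hν, hUR, hRL, hRH, hRi⟩ := (hH.mono hL.1).exists_normalIn hlt hUH hL
  -- The block `ν` differs from at least one of `σ` and `τ`. If `ν = τ`, then `|M ∩ M' : R|` is
  -- prime to `σ` and `X` is the factor to conjugate; otherwise it is prime to `τ` and `A` is
  -- conjugated.
  by_cases hντ : ν = τ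
  · have hRi' : PiIndex σᶜ R (M' ⊓ M) := by
      rw [inf_comm]
      exact hRi.mono ((hν.disjoint hσ (hντ ▸ hne.symm)).subset_compl_right)
    rw [inf_comm] at hU hMi hMi' hRL
    obtain ⟨g, hg, hgX⟩ := exists_conj_smul_le_normalizer_sup hF hH hτ hσ hM' hM hX.le hA hXU hUA hU
      hMi' hMi hUH hUR hRH hRL.le hRi'
    have hXM : MulAut.conj g • X ≤ M' := by
      rw [← hM'.conj_eq hg]; exact conj_smul_mono hX.le
    have hUX' : MulAut.conj g • X ⊓ M = U := by
      rw [← hM.conj_eq hg, ← conj_smul_inf, hXU, hUH.conj_eq hg]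
    have hTlt := sup_sup_lt hM' hM hXM hA.le (hUX'.trans_le hUR) (hAU.trans_le hUR) hRH hRL hgX
    refine key _ hTlt (hUH.mono ?_ hTlt.le) 1 (one_mem _) g hg ?_ le_sup_left ?_ ?_
    · exact hUA.trans (le_sup_left.trans le_sup_right)
    · simpa using le_sup_left.trans le_sup_right
    · simpa
    · rw [← hUX']; exact inf_le_left
  · have hRi' : PiIndex τᶜ R (M ⊓ M') := hRi.mono ((hν.disjoint hτ hντ).subset_compl_right)
    obtain ⟨g, hg, hgA⟩ := exists_conj_smul_le_normalizer_sup hF hH hσ hτ hM hM' hA.le hX hAU hUX hU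
      hMi hMi' hUH hUR hRH hRL.le hRi'
    have hAM : MulAut.conj g • A ≤ M := by
      rw [← hM.conj_eq hg]; exact conj_smul_mono hA.le
    have hUA' : MulAut.conj g • A ⊓ M' = U := by
      rw [← hM'.conj_eq hg, ← conj_smul_inf, hAU, hUH.conj_eq hg]
    have hTlt := sup_sup_lt hM hM' hAM hX.le (hUA'.trans_le hUR) (hXU.trans_le hUR) hRH hRL hgA
    refine key _ hTlt (hUH.mono ?_ hTlt.le) g hg 1 (one_mem _) le_sup_left ?_ ?_ ?_
    · exact hUX.trans (le_sup_left.trans le_sup_right)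
    · simpa using le_sup_left.trans le_sup_right
    · rw [← hUA']; exact inf_le_left
    · simpa

end CoprimeSections

end Subgroup

/-! ### Existence and conjugacy of injectors. -/

namespace Subgroup

variable {G : Type*} [Group G] [Finite G] {π σ τ : Set Nat.Primes} {F : Set (Subgroup G)}
  {M M' H K V W N : Subgroup G}

/-- Extend `V ∩ M'` to an `F`-maximal `X` of `M'`, an injector by induction. If a conjugate of `X`
lies in `V`, comparing orders gives `V ∩ M' = X`. For `σ = τ` such a conjugate comes from conjugacy
above `W ∩ M'`; for `σ ≠ τ` it comes from a common overgroup in `F` of conjugates of `W` and `X`. -/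
theorem isInjectorOf_inf_of_fmax (hF : FittingClosed π F) (hH : BlockSeparable π H)
    (ih : ∀ T < H, InjectorTheory π F T) (hM : NormalIn M H) (hσ : IsBlock π σ)
    (hi : PiIndex σ M H) (hW : IsInjectorOf F M W) (hV : FMax F H V) (hWV : W ≤ V)
    (hM' : NormalIn M' H) (hlt : M' < H) (hτ : IsBlock π τ) (hi' : PiIndex τ M' H) :
    IsInjectorOf F M' (V ⊓ M') := by
  have hVM : V ⊓ M = W := hW.fmax.inf_eq hF hM hV.mem hV.le hWV
  have hL : NormalIn (M ⊓ M') H := hM.inf hM'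
  have hLM : NormalIn (M ⊓ M') M := hL.mono inf_le_left hM.1
  have hLM' : NormalIn (M ⊓ M') M' := hL.mono inf_le_right hM'.1
  have hMi : PiIndex τ (M ⊓ M') M := PiIndex.inf_left.2 (hi'.restrict hM' hM.1)
  have hMi' : PiIndex σ (M ⊓ M') M' := PiIndex.inf_right.2 (hi.restrict hM hM'.1)
  have hU : IsInjectorOf F (M ⊓ M') (W ⊓ M') := by
    have := hW.inf hLM
    rwa [← inf_assoc, inf_eq_left.2 hW.le] at this
  have hVM'F : V ⊓ M' ∈ F := hF.of_normalIn hV.mem (hM'.inf_left hV.le)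
  obtain ⟨X, hX, hVX⟩ := FMax.exists_le hVM'F inf_le_right
  have hUX : W ⊓ M' ≤ X := (inf_le_inf_right _ hWV).trans hVX
  have hXinj := (ih M' hlt).of_fmax hLM' hσ hMi' hU hX hUX
  have hXM : X ⊓ M = W ⊓ M' := by
    have := hU.fmax.inf_eq hF hLM' hX.mem hX.le hUX
    rwa [inf_comm M M', ← inf_assoc, inf_eq_left.2 hX.le] at this
  suffices h : ∃ z ∈ H, MulAut.conj z • X ≤ V by
    obtain ⟨z, hz, hzX⟩ := h
    have hzM : MulAut.conj z • X ≤ M' := by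
      rw [← hM'.conj_eq hz]; exact conj_smul_mono hX.le
    have hc := natCard_mono (le_inf hzX hzM)
    rw [card_conj_smul] at hc
    rwa [eq_of_le_of_natCard_le hVX hc]
  by_cases hστ : σ = τ
  · subst hστ
    obtain ⟨z, hz, -, hzX⟩ := FMax.exists_conj_smul_le hF hH hσ hL
      (PiIndex.inf_normalIn hM hM'.1 hi hi') hU.fmax hV (inf_le_left.trans hWV) hX.mem hUX
      (hX.le.trans hM'.1)
    exact ⟨z, hz, hzX⟩
  · obtain ⟨E, hE, hEH, ⟨g, hg, hgA⟩, x, hx, hxX⟩ := exists_mem_conj_smul_le hF hH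
      (fun T hT => (ih T hT).exists_injector) hσ hτ hστ hM hM' hW.fmax hX rfl hXM hU.fmax hMi hMi'
    have hg' := inv_mem hg
    obtain ⟨y, hy, -, hyV⟩ := FMax.exists_conj_smul_le hF hH hσ hM hi hW.fmax hV hWV
      (hF.conj_mem g⁻¹ hE) (conj_smul_le_iff.1 hgA) (conj_smul_le_of_mem hEH hg')
    refine ⟨y * g⁻¹ * x, mul_mem (mul_mem hy hg') hx, ?_⟩
    rw [conj_mul_smul, conj_mul_smul]
    exact (conj_smul_mono (conj_smul_mono hxX)).trans hyV

theorem injectorTheory (hF : FittingClosed π F) (hH : BlockSeparable π H) :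
    InjectorTheory π F H := by
  induction hn : Nat.card H using Nat.strong_induction_on generalizing H with
  | _ n ih =>
    subst hn
    replace ih : ∀ T < H, InjectorTheory π F T := fun T hT =>
      ih _ (natCard_lt_of_lt hT) (hH.mono hT.le) rfl
    have hmain : ∀ {M σ W V}, NormalIn M H → IsBlock π σ → PiIndex σ M H → IsInjectorOf F M W →
        FMax F H V → W ≤ V → IsInjectorOf F H V := by
      intro M σ W V hM hσ hi hW hV hWV
      refine IsInjectorOf.of_normalIn hV fun K hK hKH => ?_
      -- A proper normal subgroup lies in one whose quotient belongs to a block, so only the latter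
      -- need be treated.
      obtain ⟨R, τ, hτ, hKR, hRH, hR, hRi⟩ := hH K H hKH le_rfl hK
      have h1 := isInjectorOf_inf_of_fmax hF hH ih hM hσ hi hW hV hWV hR hRH hτ hRi
      have h2 := h1.inf (hK.mono hKR hRH.le)
      rwa [inf_assoc, inf_eq_right.2 hKR] at h2
    by_cases hb : H = ⊥
    · subst hb
      have hmax : FMax F (⊥ : Subgroup G) ⊥ := ⟨⟨le_rfl, hF.bot_mem⟩, fun S hS _ => hS.1⟩
      refine ⟨⟨⊥, .of_normalIn hmax fun M _ h => absurd h not_lt_bot⟩, fun V W hV hW => ?_, hmain⟩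
      refine ⟨1, one_mem _, ?_⟩
      rw [le_bot_iff.1 hV.le, le_bot_iff.1 hW.le, smul_bot]
    · obtain ⟨M, σ, hσ, -, hlt, hM, hi⟩ := hH ⊥ H (bot_lt_iff_ne_bot.2 hb) le_rfl NormalIn.bot
      refine ⟨?_, fun V W hV hW => ?_, hmain⟩
      · obtain ⟨W, hW⟩ := (ih M hlt).exists_injector
        obtain ⟨V, hV, hWV⟩ := FMax.exists_le hW.mem (hW.le.trans hM.1)
        exact ⟨V, hmain hM hσ hi hW hV hWV⟩
      · obtain ⟨m, hm, hmW⟩ := (ih M hlt).exists_conj _ _ (hV.inf hM) (hW.inf hM)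
        have hmH := hM.1 hm
        have hle : V ⊓ M ≤ MulAut.conj m • W := by
          rw [← hmW]; exact conj_smul_mono inf_le_left
        obtain ⟨y, hy, -, hyV⟩ := FMax.exists_conj_smul_le hF hH hσ hM hi (hV.inf hM).fmax hV.fmax
          inf_le_left (hF.conj_mem m hW.mem) hle (conj_smul_le_of_mem hW.le hmH)
        refine ⟨y * m, mul_mem hy hmH, ?_⟩
        have h1 := (hW.conj hF (y * m)).fmax
        rw [conj_smul_eq_self_of_mem (mul_mem hy hmH)] at h1
        rw [← conj_mul_smul] at hyV
        exact (h1.eq hV.mem hV.le hyV).symm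

/-- `|YM : EM|` divides `|Y : E|`, with cofactor `|Y ∩ M : E ∩ M|`. -/
theorem PiIndex.sup_right {E Y : Subgroup G} (h : PiIndex σ E Y) (hE : E ≤ Y)
    (hY : Y ≤ normalizer (M : Set G)) : PiIndex σ (E ⊔ M) (Y ⊔ M) := by
  have h1 := relIndex_mul_relIndex M (E ⊔ M) (Y ⊔ M) le_sup_right (sup_le_sup_right hE M)
  have h2 := relIndex_mul_relIndex (E ⊓ M) E Y inf_le_left hE
  have h3 := relIndex_mul_relIndex (E ⊓ M) (Y ⊓ M) Y (inf_le_inf_right M hE) inf_le_left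
  rw [relIndex_sup_of_le_normalizer hY, relIndex_sup_of_le_normalizer (hE.trans hY)] at h1
  rw [inf_relIndex_left] at h2 h3
  refine IsPiNumber.of_dvd h (Dvd.intro_left ((E ⊓ M).relIndex (Y ⊓ M)) ?_)
  have h4 : 0 < M.relIndex E := Nat.pos_of_ne_zero index_ne_zero_of_finite
  apply Nat.eq_of_mul_eq_mul_left h4
  rw [h2, ← h3, ← h1]
  ring

namespace IsInjectorOf

theorem exists_mul_mem_normalizer_of_normalIn (hF : FittingClosed π F) (hH : BlockSeparable π H)
    (hM : NormalIn M H) (hW : IsInjectorOf F M W) {x : G} (hx : x ∈ H) :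
    ∃ m ∈ M, m * x ∈ normalizer (W : Set G) :=
  hW.exists_mul_mem_normalizer hF hM
    (fun W' hW' => (injectorTheory hF (hH.mono hM.1)).exists_conj W W' hW hW') hx

theorem le_of_normalizer_le (hF : FittingClosed π F) (hH : BlockSeparable π H) (hM : NormalIn M H)
    (hW : IsInjectorOf F M W) (hMN : M ≤ N) (hN : H ⊓ normalizer (W : Set G) ≤ N) : H ≤ N := by
  intro x hx
  obtain ⟨m, hm, h⟩ := hW.exists_mul_mem_normalizer_of_normalIn hF hH hM hx
  have := mul_mem (inv_mem (hMN hm)) (hN ⟨mul_mem (hM.1 hm) hx, h⟩)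
  simpa using this

/-- If `H / M` is a `σ`-group then the image of an injector in it is normal. -/
theorem sup_normalIn (hF : FittingClosed π F) (hH : BlockSeparable π H) (hσ : IsBlock π σ)
    (hM : NormalIn M H) (hi : PiIndex σ M H) (hV : IsInjectorOf F H V) : NormalIn (V ⊔ M) H := by
  obtain ⟨E, h1, h2, h3, -, -⟩ := FMax.exists_hall hF hH hσ hM hi (hV.inf hM).fmax hV.fmax
    inf_le_left
  have hEM : E ≤ normalizer (M : Set G) := (h2.trans inf_le_left).trans hM.2
  have hEH : E ⊔ M ≤ H := sup_le (h2.trans inf_le_left) hM.1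
  -- The index of `EM` in `H` is a `σ`-number since `H / M` is a `σ`-group, and a `σ'`-number since
  -- `H = N_H(V ∩ M) M` by Frattini. Hence `H = EM`, and `E` normalizes both `V` and `M`.
  have hHE : H ≤ E ⊔ M := by
    have h4 : PiIndex σ (E ⊔ M) H := hi.right le_sup_right
    have h5 := h3.sup_right h2 (inf_le_left.trans hM.2)
    have h6 : H ≤ H ⊓ normalizer ((V ⊓ M : Subgroup G) : Set G) ⊔ M :=
      (hV.inf hM).le_of_normalizer_le hF hH hM le_sup_right le_sup_left
    rw [le_antisymm (sup_le inf_le_left hM.1) h6] at h5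
    exact PiIndex.le disjoint_compl_right h4 h5
  refine ⟨sup_le hV.le hM.1, hHE.trans (sup_le ?_ (le_sup_right.trans le_normalizer))⟩
  exact (le_inf h1.2 hEM).trans (normalizer_inf_normalizer_le_normalizer_sup V M)

end IsInjectorOf

end Subgroup

/-! ### The `𝔑^π`-residual and Dnormal subgroups. -/

namespace Subgroup

variable {G : Type*} [Group G] {π : Set Nat.Primes} {F : Set (Subgroup G)}
  {M H K V W N : Subgroup G}

theorem index_eq_card_of_isCompl {H K : Subgroup G} (hK : K.Normal)
    (h1 : H ⊓ K = ⊥) (h2 : H ⊔ K = ⊤) : K.index = Nat.card H := by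
  rw [← relIndex_top_right, ← h2, relIndex_sup_of_le_normalizer le_normalizer_of_normal,
    ← inf_relIndex_left, h1, relIndex_bot_left]

theorem isNilpotent_quotient_iff [N.Normal] :
    Group.IsNilpotent (G ⧸ N) ↔ ∃ n, (⊤ : Subgroup G).lowerCentralSeries n ≤ N := by
  have h (n : ℕ) : (⊤ : Subgroup (G ⧸ N)).lowerCentralSeries n =
      ((⊤ : Subgroup G).lowerCentralSeries n).map (QuotientGroup.mk' N) := by
    rw [map_lowerCentralSeries, map_top_of_surjective _ (QuotientGroup.mk'_surjective N)]
  rw [nilpotent_iff_lowerCentralSeries]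
  refine exists_congr fun n => ?_
  rw [h, map_eq_bot_iff, QuotientGroup.ker_mk']

theorem exists_reducesInto (p : Nat.Primes) (N : Subgroup G) :
    ∃ P : Sylow (p : ℕ) G, ReducesInto P N := by
  obtain ⟨P, hP⟩ := Sylow.exists_comap_subtype_eq (default : Sylow (p : ℕ) N)
  exact ⟨P, default, hP.symm⟩

theorem subnormalIn_top_iff : SubnormalIn K ⊤ ↔ K.IsSubnormal := by
  constructor
  · intro h
    induction h using Relation.ReflTransGen.head_induction_on with
    | refl => exact .top
    | head h _ ih => exact .step _ _ h.1 ih h.subgroupOf_normal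
  · intro h
    induction h with
    | top => exact .refl
    | step A B h1 _ h2 ih => exact .head ((NormalIn.iff_subgroupOf h1).2 h2) ih

theorem SubnormalIn.map {G' : Type*} [Group G'] (f : G →* G') (h : SubnormalIn K H) :
    SubnormalIn (K.map f) (H.map f) := by
  induction h with
  | refl => exact .refl
  | tail _ h ih =>
    exact ih.tail ⟨map_mono h.1, (map_mono h.2).trans (le_normalizer_map f)⟩

theorem isInjectorOf_top_iff : IsInjectorOf F ⊤ V ↔ IsInjector F V := by
  refine ⟨fun h K hK => h.2 K (subnormalIn_top_iff.2 hK),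
    fun h => ⟨le_top, fun K hK => h K (subnormalIn_top_iff.1 hK)⟩⟩

theorem IsInjectorOf.isInjector_subgroupOf (h : IsInjectorOf F N V) :
    IsInjector (traceSet F N) (V.subgroupOf N) := by
  intro K hK
  have h1 := (subnormalIn_top_iff.2 hK).map N.subtype
  rw [← MonoidHom.range_eq_map, range_subtype] at h1
  have h2 := h.2 _ h1
  have h3 : (V.subgroupOf N ⊓ K).map N.subtype = V ⊓ K.map N.subtype := by
    rw [map_inf _ _ _ N.subtype_injective, subgroupOf_map_subtype, inf_eq_left.2 h.1]
  refine ⟨⟨inf_le_right, ?_⟩, fun S hS hle => ?_⟩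
  · change (V.subgroupOf N ⊓ K).map N.subtype ∈ F
    rw [h3]; exact h2.mem
  · rw [← map_le_map_iff_of_injective N.subtype_injective, h3]
    refine h2.le_of_ge ⟨map_mono hS.1, hS.2⟩ ?_
    rw [← h3]; exact map_mono hle

variable [Finite G]

/-- The `𝔑^π`-residual contains the intersection of the `π`-residual and the nilpotent
`π'`-residual. -/
theorem exists_inf_le_nPiResidual (π : Set Nat.Primes) (G : Type*) [Group G] [Finite G] :
    ∃ N₁ N₂ : Subgroup G, ∃ _ : N₁.Normal, ∃ _ : N₂.Normal, IsPiNumber π N₁.index ∧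
      IsPiNumber πᶜ N₂.index ∧ Group.IsNilpotent (G ⧸ N₂) ∧ N₁ ⊓ N₂ ≤ nPiResidual π G := by
  obtain ⟨N₁, ⟨-, h1, h2⟩, h3⟩ := exists_least_piIndex π (bot_le (a := (⊤ : Subgroup G)))
  obtain ⟨N₂, hN₂⟩ := (Set.toFinite {N : Subgroup G | N.Normal ∧ IsPiNumber πᶜ N.index ∧
    ∃ n, (⊤ : Subgroup G).lowerCentralSeries n ≤ N}).exists_minimal
    ⟨⊤, inferInstance, by rw [index_top]; exact IsPiNumber.one, 0, le_top⟩
  obtain ⟨k1, k2, n, k3⟩ := hN₂.prop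
  have hmin : ∀ N : Subgroup G, N.Normal → IsPiNumber πᶜ N.index →
      (∃ n, (⊤ : Subgroup G).lowerCentralSeries n ≤ N) → N₂ ≤ N := by
    rintro N a1 a2 ⟨m, a3⟩
    refine (hN₂.le_of_le (y := N₂ ⊓ N) ⟨normal_inf_normal N₂ N, ?_, max n m, le_inf ?_ ?_⟩
      inf_le_left).trans inf_le_right
    · rw [← relIndex_top_right] at a2 k2 ⊢
      exact PiIndex.inf_normalIn (NormalIn.top_iff.2 k1) le_top k2 a2
    · exact (lowerCentralSeries_antitone _ (le_max_left _ _)).trans k3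
    · exact (lowerCentralSeries_antitone _ (le_max_right _ _)).trans a3
  refine ⟨N₁, N₂, NormalIn.top_iff.1 h1, k1, by rwa [← relIndex_top_right], k2,
    isNilpotent_quotient_iff.2 ⟨n, k3⟩, le_sInf ?_⟩
  -- With `G / N = H × K`, the preimage of `K` has `π`-index and contains `N₁`, while the preimage
  -- of `H` has nilpotent `π'`-quotient and contains `N₂`. So `N₁ ∩ N₂` maps into `H ∩ K = 1`.
  rintro N ⟨hN, H, K, hH, hK, hinf, hsup, hHπ, hKπ, hKn⟩
  set f := QuotientGroup.mk' N
  have hf : Function.Surjective f := QuotientGroup.mk'_surjective N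
  have e1 : N₁ ≤ comap f K := by
    refine h3 _ bot_le (NormalIn.top_iff.2 (hK.comap f)) ?_
    unfold PiIndex
    rw [relIndex_top_right, index_comap_of_surjective K hf, index_eq_card_of_isCompl hK hinf hsup]
    exact hHπ
  have hsup' : K ⊔ H = ⊤ := sup_comm H K ▸ hsup
  have e2 : N₂ ≤ comap f H := by
    refine hmin _ (hH.comap f) ?_ ?_
    · rw [index_comap_of_surjective H hf,
        index_eq_card_of_isCompl hH (inf_comm H K ▸ hinf) hsup']
      exact hKπ
    · have hq : Group.IsNilpotent ((G ⧸ N) ⧸ H) := by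
        refine Group.nilpotent_of_surjective ((QuotientGroup.mk' H).comp K.subtype) fun x => ?_
        obtain ⟨x, rfl⟩ := QuotientGroup.mk'_surjective H x
        obtain ⟨k, hk, h, hh, rfl⟩ := exists_mul_of_mem_sup
          (le_normalizer_of_normal : K ≤ normalizer (H : Set (G ⧸ N)))
          (hsup'.ge (mem_top x))
        refine ⟨⟨k, hk⟩, ?_⟩
        have : (QuotientGroup.mk' H) h = 1 := (QuotientGroup.eq_one_iff h).2 hh
        rw [map_mul, this, mul_one]; rfl
      obtain ⟨m, hm⟩ := isNilpotent_quotient_iff.1 hq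
      refine ⟨m, map_le_iff_le_comap.1 ?_⟩
      rwa [map_lowerCentralSeries, map_top_of_surjective f hf]
  intro x hx
  have : f x ∈ H ⊓ K := ⟨e2 hx.2, e1 hx.1⟩
  rw [hinf, mem_bot] at this
  exact (QuotientGroup.eq_one_iff x).1 this

/-- The index of `A(N₁ ∩ N₂)` divides both `|N₂ : N₁ ∩ N₂|` and `|N₁ : N₁ ∩ N₂|`, a `π`-number and a
`π'`-number. -/
theorem sup_eq_top_of_coprime {A N₁ N₂ : Subgroup G} [N₁.Normal] [N₂.Normal]
    (h1 : IsPiNumber π N₁.index) (h2 : IsPiNumber πᶜ N₂.index) (hA1 : A ⊔ N₁ = ⊤)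
    (hA2 : A ⊔ N₂ = ⊤) : A ⊔ (N₁ ⊓ N₂) = ⊤ := by
  rw [← relIndex_top_right] at h1 h2
  have key : ∀ {σ : Set Nat.Primes} {N N' : Subgroup G} [N.Normal] [N'.Normal],
      PiIndex σ N' ⊤ → A ⊔ N = ⊤ → N ⊓ N' ≤ A ⊔ (N₁ ⊓ N₂) →
      PiIndex σ (A ⊔ (N₁ ⊓ N₂)) ⊤ := by
    intro σ N N' _ hN' hi hA hle
    have h3 : (A ⊔ (N₁ ⊓ N₂)) ⊔ N = ⊤ := top_le_iff.1 (hA ▸ sup_le_sup_right le_sup_left N)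
    unfold PiIndex
    rw [← h3, relIndex_sup_left_of_le_normalizer le_normalizer_of_normal]
    exact (PiIndex.inf_left.2 (hi.restrict (NormalIn.top_iff.2 hN') le_top)).right hle
  have e1 := key h1 hA2 (inf_comm N₂ N₁ ▸ le_sup_right)
  have e2 := key h2 hA1 le_sup_right
  exact top_le_iff.1 (PiIndex.le disjoint_compl_right e1 e2)

namespace IsInjectorOf

/-- By Frattini `G = N_G(V) M` for every normal `M ≥ V`. Taking `M = V N₁`, which is normal, gives
`G = N_G(V) N₁`. If `N_G(V) N₂` were proper, nilpotency would put it in a proper normal `M`,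
contradicting `G = N_G(V) M = M`. -/
theorem normalizer_sup_eq_top (hF : FittingClosed π F) (hG : BlockSeparable π (⊤ : Subgroup G))
    (hV : IsInjectorOf F ⊤ V) {N₁ N₂ : Subgroup G} [N₁.Normal] [N₂.Normal]
    [Group.IsNilpotent (G ⧸ N₂)] (h1 : IsPiNumber π N₁.index) (h2 : IsPiNumber πᶜ N₂.index) :
    normalizer (V : Set G) ⊔ (N₁ ⊓ N₂) = ⊤ := by
  have hVN : V ≤ normalizer (V : Set G) := le_normalizer
  have hle : ∀ M : Subgroup G, NormalIn M ⊤ → V ≤ M → normalizer (V : Set G) ⊔ M = ⊤ := by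
    intro M hM hVM
    have := hV.inf hM
    rw [inf_eq_left.2 hVM] at this
    exact top_le_iff.1 (this.le_of_normalizer_le hF hG hM le_sup_right
      (inf_le_right.trans le_sup_left))
  refine sup_eq_top_of_coprime h1 h2 ?_ ?_
  · rw [← relIndex_top_right] at h1
    have := hle _ (hV.sup_normalIn hF hG (.inl rfl) (NormalIn.top_iff.2 inferInstance) h1)
      le_sup_left
    rwa [← sup_assoc, sup_eq_left.2 hVN] at this
  · by_contra hne
    obtain ⟨M, hM, hle', hne'⟩ := exists_normal_lt_top_of_isNilpotent (W := N₂) le_sup_right hne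
    have hNM := le_sup_left.trans hle'
    have := hle M (NormalIn.top_iff.2 hM) (hVN.trans hNM)
    rw [sup_eq_right.2 hNM] at this
    exact hne' this

theorem exists_mem_nPiResidual (hF : FittingClosed π F)
    (hG : BlockSeparable π (⊤ : Subgroup G)) (hV : IsInjectorOf F ⊤ V)
    (hW : IsInjectorOf F ⊤ W) : ∃ g ∈ nPiResidual π G, MulAut.conj g⁻¹ • W = V := by
  obtain ⟨N₁, N₂, _, _, h1, h2, _, h3⟩ := exists_inf_le_nPiResidual π G
  obtain ⟨x, -, hx⟩ := (injectorTheory hF hG).exists_conj V W hV hW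
  have htop := hV.normalizer_sup_eq_top hF hG h1 h2
  obtain ⟨n, hn, k, hk, rfl⟩ := exists_mul_of_mem_sup le_normalizer_of_normal
    (htop.ge (mem_top x))
  refine ⟨k⁻¹, inv_mem (h3 hk), ?_⟩
  rw [conj_mul_smul] at hx
  rw [inv_inv, ← conj_inv_smul_smul n (MulAut.conj k • W), hx]
  exact mem_normalizer_iff_conj_smul_eq.1 (inv_mem hn)

/-- `V ∩ T` belongs to `F` and contains the injector `V ∩ K` of `K`, so only its `F`-maximality in
`T` is at stake. A larger member `S` has a conjugate in `V`, hence lies in the normal subgroup `VK`;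
as `S ∩ K = V ∩ K`, a Dedekind argument gives `S ≤ V`. -/
theorem inf_of_piIndex (hF : FittingClosed π F) (hH : BlockSeparable π H) (hπ : π.Nontrivial)
    (hK : NormalIn K H) (hi : PiIndex π K H) (hV : IsInjectorOf F H V) {T : Subgroup G}
    (hKT : K ≤ T) (hTH : T ≤ H) : IsInjectorOf F T (V ⊓ T) := by
  have hW := hV.inf hK
  have hWT : V ⊓ K ≤ V ⊓ T := inf_le_inf_left V hKT
  have hmem : V ⊓ T ∈ F := hF.of_piIndex hπ hV.mem (hK.inf_left hV.le)
    (PiIndex.inf_left.2 (hi.restrict hK hV.le)) hWT inf_le_left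
  refine (injectorTheory hF (hH.mono hTH)).of_fmax (hK.mono hKT hTH) (.inl rfl)
    (hi.left hKT hTH) hW ⟨⟨inf_le_right, hmem⟩, fun S hS hVS => ?_⟩ hWT
  obtain ⟨y, hy, -, hyS⟩ := FMax.exists_conj_smul_le hF hH (.inl rfl) hK hi hW.fmax hV.fmax
    inf_le_left hS.2 (hWT.trans hVS) (hS.1.trans hTH)
  have hSVK : S ≤ V ⊔ K := by
    rw [← (hV.sup_normalIn hF hH (.inl rfl) hK hi).conj_eq (inv_mem hy)]
    exact (conj_smul_le_iff.1 hyS).trans (conj_smul_mono le_sup_left)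
  have hSK : S ⊓ K = V ⊓ K := hW.fmax.inf_eq hF hK hS.2 (hS.1.trans hTH) (hWT.trans hVS)
  intro s hs
  obtain ⟨v, hv, k, hk, rfl⟩ := exists_mul_of_mem_sup (hV.le.trans hK.2) (hSVK hs)
  have hvT : v ∈ T := by
    have := T.mul_mem (hS.1 hs) (T.inv_mem (hKT hk)); simpa using this
  have hkS : k ∈ S := by
    have := S.mul_mem (S.inv_mem (hVS ⟨hv, hvT⟩)) hs; simpa using this
  exact ⟨mul_mem hv (hSK.le ⟨hkS, hk⟩).1, hS.1 hs⟩

end IsInjectorOf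

theorem eq_top_of_forall_sylow_le {B : Subgroup G}
    (h : ∀ p : Nat.Primes, ∃ P : Sylow (p : ℕ) G, (P : Subgroup G) ≤ B) : B = ⊤ := by
  rw [← index_eq_one]
  by_contra hne
  obtain ⟨p, hp, hd⟩ := Nat.exists_prime_and_dvd hne
  have : Fact p.Prime := ⟨hp⟩
  obtain ⟨P, hP⟩ := h ⟨p, hp⟩
  exact P.not_dvd_index (hd.trans (index_dvd_of_le hP))

/-- `P ∩ R` is Sylow in the normal subgroup `R`, and `|N : R|` is prime to `p`. -/
theorem reducesInto_of_piIndex {R : Subgroup G} [R.Normal] (hRN : R ≤ N) (hi : PiIndex π R N)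
    {p : Nat.Primes} (hp : p ∉ π) (P : Sylow (p : ℕ) G) : ReducesInto P N := by
  have : Fact (p : ℕ).Prime := ⟨p.2⟩
  have hP : IsPGroup (p : ℕ) ((P : Subgroup G).subgroupOf N) :=
    P.isPGroup'.comap_of_injective _ N.subtype_injective
  have hd : ¬ (p : ℕ) ∣ ((P : Subgroup G).subgroupOf N).index := by
    intro hd
    have h1 := relIndex_mul_relIndex ((P : Subgroup G) ⊓ R) R N inf_le_right hRN
    have h2 : (p : ℕ) ∣ ((P : Subgroup G) ⊓ R).relIndex N :=
      hd.trans (relIndex_dvd_of_le_left N inf_le_left)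
    rw [← h1, inf_relIndex_right, p.2.dvd_mul] at h2
    rcases h2 with h2 | h2
    · rw [← relIndex_sup_left_of_le_normalizer le_normalizer_of_normal] at h2
      exact P.not_dvd_index (h2.trans (relIndex_dvd_index_of_le le_sup_left))
    · exact hp (hi p h2)
  exact ⟨hP.toSylow hd, rfl⟩

theorem _root_.IsDnormal.normal_of_not_nontrivial (hN : IsDnormal π N) (hπ : ¬π.Nontrivial) :
    N.Normal := by
  rw [← normalizer_eq_top_iff]
  refine eq_top_of_forall_sylow_le fun p => ?_
  obtain ⟨P, hP⟩ := exists_reducesInto p N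
  refine ⟨P, ?_⟩
  by_cases hp : p ∈ π
  · exact (hN.2 p hp P hP).1 ((Set.not_nontrivial_iff.1 hπ).eq_singleton_of_mem hp)
  · exact hN.1 p hp P hP

/-- For each prime some Sylow subgroup normalizes `O^π(N)`, so `O^π(N)` is normal in `G`. Hence
every Sylow `p`-subgroup with `p ∉ π` reduces into `N` and normalizes it; these subgroups together
generate `K`. -/
theorem _root_.IsDnormal.exists_normalIn_le_normalizer (hN : IsDnormal π N) (hπ : π.Nontrivial) :
    ∃ K : Subgroup G, NormalIn K ⊤ ∧ PiIndex π K ⊤ ∧ K ≤ normalizer (N : Set G) := by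
  obtain ⟨⟨h1, h2⟩, -⟩ := piResidual_map_subtype (π := π) N
  have hR : ((piResidual π N).map N.subtype).Normal := by
    rw [← normalizer_eq_top_iff]
    refine eq_top_of_forall_sylow_le fun p => ?_
    obtain ⟨P, hP⟩ := exists_reducesInto p N
    refine ⟨P, ?_⟩
    by_cases hp : p ∈ π
    · exact (hN.2 p hp P hP).2 hπ
    · exact (hN.1 p hp P hP).trans
        (normalIn_piResidual_map_subtype (Y := normalizer (N : Set G)) ⟨le_normalizer, le_rfl⟩).2
  let 𝒮 : Set (Subgroup G) := {P | ∃ p ∉ π, ∃ Q : Sylow (p : ℕ) G, P = Q}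
  have hmem : ∀ p ∉ π, ∀ Q : Sylow (p : ℕ) G, (Q : Subgroup G) ≤ sSup 𝒮 :=
    fun p hp Q => le_sSup ⟨p, hp, Q, rfl⟩
  refine ⟨sSup 𝒮, NormalIn.of_conj_smul_le le_top fun x _ => ?_, ?_, sSup_le ?_⟩
  · rw [conj_smul_le_iff]
    refine sSup_le ?_
    rintro _ ⟨p, hp, Q, rfl⟩
    rw [← inv_inv x, ← conj_smul_le_iff, inv_inv]
    exact hmem p hp (x • Q)
  · intro p hd
    by_contra hp
    rw [relIndex_top_right] at hd
    have : Fact (p : ℕ).Prime := ⟨p.2⟩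
    let Q : Sylow (p : ℕ) G := default
    exact Q.not_dvd_index (hd.trans (index_dvd_of_le (hmem p hp Q)))
  · rintro _ ⟨p, hp, Q, rfl⟩
    exact hN.1 p hp Q (reducesInto_of_piIndex h1.1 h2 hp Q)

theorem IsInjectorOf.inf_of_isDnormal (hF : FittingClosed π F)
    (hG : BlockSeparable π (⊤ : Subgroup G)) (hV : IsInjectorOf F ⊤ V) (hN : IsDnormal π N) :
    IsInjectorOf F N (V ⊓ N) := by
  by_cases hπ : π.Nontrivial
  · obtain ⟨K, hK, hKi, hKN⟩ := hN.exists_normalIn_le_normalizer hπ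
    have h1 := hV.inf_of_piIndex hF hG hπ hK hKi (T := K ⊔ N) le_sup_left le_top
    have h2 := h1.inf (NormalIn.sup_of_le hKN)
    rwa [inf_assoc, inf_eq_right.2 (le_sup_right : N ≤ K ⊔ N)] at h2
  · exact hV.inf (NormalIn.top_iff.2 (hN.normal_of_not_nontrivial hπ))

end Subgroup

open Subgroup in
theorem theorem2 {G : Type*} [Group G] [Finite G] (π : Set Nat.Primes)
    (hG : IsPiSoluble πᶜ G) (F : Set (Subgroup G)) (hF : IsNPiFittingSet π F) :
    (∃ V : Subgroup G,
      {I : Subgroup G | IsInjector F I} = {I | ∃ g : G, I = MulAut.conj g⁻¹ • V}) ∧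
    (∀ V W : Subgroup G, IsInjector F V → IsInjector F W →
      ∃ g ∈ nPiResidual π G, MulAut.conj g⁻¹ • W = V) ∧
    (∀ I N : Subgroup G, IsInjector F I → IsDnormal π N →
      IsInjector (traceSet F N) ((I ⊓ N).subgroupOf N)) := by
  have hF' := hF.fittingClosed
  have hs : BlockSeparable π (⊤ : Subgroup G) := blockSeparable_of_isPiSoluble hG ⊤
  refine ⟨?_, fun V W hV hW => ?_, fun I N hI hN => ?_⟩
  · obtain ⟨V, hV⟩ := (injectorTheory hF' hs).exists_injector
    refine ⟨V, Set.ext fun I => ⟨fun hI => ?_, ?_⟩⟩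
    · obtain ⟨g, -, hg⟩ := hV.exists_mem_nPiResidual hF' hs (isInjectorOf_top_iff.2 hI)
      exact ⟨g⁻¹, by rw [← hg, conj_inv_smul_smul]⟩
    · rintro ⟨g, rfl⟩
      have := hV.conj hF' g⁻¹
      rw [conj_smul_eq_self_of_mem (mem_top _)] at this
      exact isInjectorOf_top_iff.1 this
  · exact (isInjectorOf_top_iff.2 hV).exists_mem_nPiResidual hF' hs (isInjectorOf_top_iff.2 hW)
  · exact ((isInjectorOf_top_iff.2 hI).inf_of_isDnormal hF' hs hN).isInjector_subgroupOf
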